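/- Asymptotic formulae (A) and (B). Let $Z(t)=e^{i\vartheta(t)}\zeta(\tfrac12+it)$ be the Riemann–Siegel (Hardy) function, where $\vartheta(t)=\operatorname{Im}\log\Gamma(\tfrac14+\tfrac{it}{2})-\tfrac t2\log\pi$. Assume the Riemann hypothesis, and let $\gamma$ run over the ordinates, positive and negative, of the zeros $\tfrac12+i\gamma$ of $\zeta$, counted with multiplicity. Let $t_0\to+\infty$ through any sequence of positive numbers such that $Z'(t_0)=0$ and $\gamma'<t_0<\gamma''$ for some neighboring zero ordinates $0<\gamma'<\gamma''$ (which may depend on $t_0$). Then all the series below converge absolutely, and, where $f\sim g$ means $f-g=o(g)$: - $\displaystyle \lim_{t_0\to\infty}\sum_\gamma\frac{t_0}{\gamma^2-t_0^2}=\frac{\pi}{4}$, that is, $\displaystyle \sum_\gamma\frac{1}{\gamma^2-t_0^2}\sim\frac{\pi}{4t_0}$; - (A) $\displaystyle \sum_\gamma\frac{1}{(t_0-\gamma)^2}\sim 2\sum_\gamma\frac{t_0^2}{(t_0^2-\gamma^2)^2}-\frac{\pi}{4t_0}$, and, to the precision of the term $\pi/(4t_0)$, $\displaystyle \sum_\gamma\frac{1}{(t_0-\gamma)^2}-2\sum_\gamma\frac{\gamma^2}{(t_0^2-\gamma^2)^2}\sim-\frac{\pi}{4t_0}$;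 - (B) $\displaystyle \sum_\gamma\frac{t_0^2}{(t_0^2-\gamma^2)^2}\sim\sum_\gamma\frac{\gamma^2}{(t_0^2-\gamma^2)^2}-\frac{\pi}{4t_0}$, and, to the precision of the term $\pi/(4t_0)$, $\displaystyle \sum_\gamma\frac{t_0^2}{(t_0^2-\gamma^2)^2}-\sum_\gamma\frac{\gamma^2}{(t_0^2-\gamma^2)^2}\sim-\frac{\pi}{4t_0}$. -/

import Mathlib

open Filter Topology Asymptotics

noncomputable section

/-- The point `1/2 + i t` of the critical line. -/
def criticalPoint (t : ℝ) : ℂ := 1 / 2 + (t : ℂ) * Complex.I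

/-- The unit complex number `exp (i ϑ(t))`, where
`ϑ(t) = Im log Γ(1/4 + i t / 2) - (t / 2) log π` is the Riemann-Siegel theta function: it is the
phase of `π ^ (-s / 2) * Γ(s / 2)` at `s = 1/2 + i t`. -/
def thetaPhase (t : ℝ) : ℂ :=
  Complex.Gammaℝ (criticalPoint t) / (‖Complex.Gammaℝ (criticalPoint t)‖ : ℂ)

/-- The Riemann-Siegel (Hardy) function `Z(t) = exp (i ϑ(t)) ζ(1/2 + i t)`, as a real-valued
function. The product is real, see `ofReal_hardyZ`, so that taking the real part loses nothing. -/
def hardyZ (t : ℝ) : ℝ := (thetaPhase t * riemannZeta (criticalPoint t)).re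

theorem ofReal_hardyZ (t : ℝ) :
    (hardyZ t : ℂ) = thetaPhase t * riemannZeta (criticalPoint t) := by
  have hs1 : criticalPoint t ≠ 1 := by
    intro h
    have := congrArg Complex.re h
    norm_num [criticalPoint] at this
  have hs0 : criticalPoint t ≠ 0 := by
    intro h
    have := congrArg Complex.re h
    norm_num [criticalPoint] at this
  have hre : 0 < (criticalPoint t).re := by norm_num [criticalPoint]
  have hG := Complex.Gammaℝ_ne_zero_of_re_pos hre
  have hconj : (starRingEnd ℂ) (criticalPoint t) = 1 - criticalPoint t := by
    apply Complex.ext <;> norm_num [criticalPoint]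
  have hre' : 0 < (1 - criticalPoint t).re := by norm_num [criticalPoint]
  have hG' := Complex.Gammaℝ_ne_zero_of_re_pos hre'
  have hs0' : 1 - criticalPoint t ≠ 0 := sub_ne_zero.mpr hs1.symm
  have hz : ∀ s : ℂ, s ≠ 0 → Complex.Gammaℝ s ≠ 0 →
      Complex.Gammaℝ s * riemannZeta s = completedRiemannZeta s := by
    intro s h0 h1
    rw [riemannZeta_def_of_ne_zero h0]
    field_simp
  have hGc : (starRingEnd ℂ) (Complex.Gammaℝ (criticalPoint t)) =
      Complex.Gammaℝ ((starRingEnd ℂ) (criticalPoint t)) := by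
    have harg : ((Real.pi : ℝ) : ℂ).arg ≠ Real.pi := by
      rw [Complex.arg_ofReal_of_nonneg Real.pi_pos.le]
      exact Real.pi_pos.ne
    have h1 := Complex.cpow_conj ((Real.pi : ℝ) : ℂ) (-(criticalPoint t) / 2) harg
    have h2 := Complex.Gamma_conj (criticalPoint t / 2)
    simp only [map_div₀, map_neg, Complex.conj_ofReal, map_ofNat] at h1 h2
    rw [Complex.Gammaℝ_def, Complex.Gammaℝ_def, map_mul, h1, h2]
  have key : (starRingEnd ℂ) (thetaPhase t * riemannZeta (criticalPoint t)) =
      thetaPhase t * riemannZeta (criticalPoint t) := by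
    have e1 : (starRingEnd ℂ)
        (Complex.Gammaℝ (criticalPoint t) * riemannZeta (criticalPoint t)) =
        Complex.Gammaℝ (criticalPoint t) * riemannZeta (criticalPoint t) := by
      rw [map_mul, hGc, ← riemannZeta_conj, hconj, hz _ hs0' hG', hz _ hs0 hG,
        completedRiemannZeta_one_sub]
    have e2 : thetaPhase t * riemannZeta (criticalPoint t) =
        Complex.Gammaℝ (criticalPoint t) * riemannZeta (criticalPoint t) /
          (‖Complex.Gammaℝ (criticalPoint t)‖ : ℂ) := by
      rw [thetaPhase]
      ring
    rw [e2, map_div₀, e1, Complex.conj_ofReal]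
  exact Complex.conj_eq_iff_re.mp key

/-- `a` and `b` are the ordinates of neighboring zeros of `ζ` in the upper half of the critical
line. -/
def NeighboringZeros (a b : ℝ) : Prop :=
  0 < a ∧ a < b ∧ riemannZeta (criticalPoint a) = 0 ∧ riemannZeta (criticalPoint b) = 0 ∧
    ∀ x : ℝ, a < x → x < b → riemannZeta (criticalPoint x) ≠ 0

/-- `t` is a critical point of `Z` strictly between two neighboring zeros. -/
def IsCriticalPointOfZ (t : ℝ) : Prop :=
  (∃ a b : ℝ, NeighboringZeros a b ∧ a < t ∧ t < b) ∧ deriv hardyZ t = 0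

/-- The ordinates `γ`, positive and negative, of the zeros `1/2 + i γ` of `ζ`. -/
abbrev ZeroOrdinate : Type := {γ : ℝ // riemannZeta (criticalPoint γ) = 0}

/-- The multiplicity of the zero `1/2 + i γ` of `ζ`. -/
def zeroMult (γ : ℝ) : ℕ := analyticOrderNatAt riemannZeta (criticalPoint γ)

/-- Absolute convergence of `∑_γ f(γ)`, zeros counted with multiplicity. -/
def ZeroSummable (f : ℝ → ℝ) : Prop :=
  Summable fun γ : ZeroOrdinate => (zeroMult γ.1 : ℝ) * f γ.1

/-- The sum `∑_γ f(γ)`, zeros counted with multiplicity. -/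
def zeroSum (f : ℝ → ℝ) : ℝ :=
  ∑' γ : ZeroOrdinate, (zeroMult γ.1 : ℝ) * f γ.1

end

/-! Write `ξ` for `riemannXi`, and U, A, B, V for the sums over γ of 1/(t-γ)², t²/(t²-γ²)²,
γ²/(t²-γ²)² and 1/(γ²-t²). Pairing γ with -γ gives U = A + B, and subtracting numerators gives A - B
= -V. Everything thus reduces to two facts: t·V → π/4, and U → ∞.

The first fact. Under the Riemann hypothesis, Hadamard's expansion reads i·ξ'/ξ(1/2+iz) = ∑
z/(z²-γ²) (`hasSum_logDeriv_riemannXi`). For z = t real this gives t·V = Im ξ'/ξ(1/2+it). Now ξ'/ξ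
splits into rational terms of size O(1/t), the Gamma factor, and ζ'/ζ. Since Z² = |ζ|² on the
critical line, Z'(t) = 0 with ζ ≠ 0 forces Im ζ'/ζ = 0 there. Only half of Im ψ(1/4+it/2) survives,
and Im ψ → π/2 by comparing its series with arctan, whence π/4.

The second fact. On Re s = 2, ζ'/ζ is bounded while Re ψ(1+it/2) → ∞, so Re ξ'/ξ(2+it) → ∞; its
partial fractions are dominated termwise by those of (3/2)U.

The precise forms of (A) and (B) both say A - B = -V ~ -π/(4t). In the equivalences of the two sides
the term π/(4t) carries no weight: the difference tends to 0 and the right side tends to infinity.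

The expansion itself comes from dividing out the zeros in a disk of radius R, applying
Borel–Carathéodory to the logarithm of the zero-free quotient, and using log|ξ| = o(R²)
(`Complex.tendsto_sum_logDeriv`). -/

namespace Complex

/-! ### The digamma function on vertical lines -/

theorem norm_GammaSeq_le_Gamma_re {s : ℂ} (hs : 0 < s.re) {n : ℕ} (hn : n ≠ 0) :
    ‖GammaSeq s n‖ ≤ Real.Gamma s.re := by
  have hn' : (0 : ℝ) < n := by exact_mod_cast Nat.pos_of_ne_zero hn
  have hpos : ∀ j : ℕ, 0 < s.re + j := fun j => by positivity
  have h1 : ‖GammaSeq s n‖ ≤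
      (n : ℝ) ^ s.re * n.factorial / ∏ j ∈ Finset.range (n + 1), (s.re + j) := by
    rw [GammaSeq, norm_div, norm_mul, norm_natCast_cpow_of_pos (Nat.pos_of_ne_zero hn),
      norm_natCast, norm_prod]
    refine div_le_div_of_nonneg_left (by positivity) (Finset.prod_pos fun j _ => hpos j) ?_
    refine Finset.prod_le_prod (fun j _ => (hpos j).le) fun j _ => ?_
    simpa using re_le_norm (s + j)
  refine h1.trans ?_
  -- Since |s+j| ≥ Re s + j, it remains to treat real arguments, where log-convexity puts every term
  -- of Euler's sequence below Γ.
  have h2 := Real.BohrMollerup.ge_logGammaSeq (f := Real.log ∘ Real.Gamma) (n := n)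
    Real.convexOn_log_Gamma (fun {y} hy => by
      simp only [Function.comp_apply]
      rw [Real.Gamma_add_one hy.ne', Real.log_mul hy.ne' (Real.Gamma_pos_of_pos hy).ne', add_comm])
    hs hn
  simp only [Function.comp_apply, Real.Gamma_one, Real.log_one, zero_add,
    Real.BohrMollerup.logGammaSeq] at h2
  rw [← Real.exp_log (Real.Gamma_pos_of_pos hs)]
  refine le_trans (le_of_eq ?_) (Real.exp_le_exp.mpr h2)
  rw [← Real.log_prod (fun j _ => (hpos j).ne'), Real.exp_sub, Real.exp_add,
    Real.exp_log (by positivity), Real.exp_log (Finset.prod_pos fun j _ => hpos j),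
    Real.rpow_def_of_pos hn', mul_comm (Real.log _)]

/-- Pointwise convergence of holomorphic functions dominated on a circle implies convergence of
the derivatives at the center. -/
theorem tendsto_deriv_of_dominated_on_circle {f : ℕ → ℂ → ℂ} {g : ℂ → ℂ} {U : Set ℂ}
    (hU : IsOpen U) {c : ℂ} {r : ℝ} (hr : 0 < r) (hc : Metric.closedBall c r ⊆ U)
    (hf : ∀ᶠ n in atTop, DifferentiableOn ℂ (f n) U) (hg : DifferentiableOn ℂ g U) {M : ℝ}
    (hM : ∀ᶠ n in atTop, ∀ w ∈ Metric.sphere c r, ‖f n w‖ ≤ M)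
    (hlim : ∀ w ∈ U, Tendsto (fun n => f n w) atTop (𝓝 (g w))) :
    Tendsto (fun n => deriv (f n) c) atTop (𝓝 (deriv g c)) := by
  have hsph : ∀ θ, circleMap c r θ ∈ Metric.sphere c r := fun θ => circleMap_mem_sphere c hr.le θ
  have hsub : Metric.sphere c r ⊆ U := Metric.sphere_subset_closedBall.trans hc
  rw [← cderiv_eq_deriv hU hg hr hc]
  -- The derivative at the center is a Cauchy integral over the circle, so dominated convergence
  -- replaces locally uniform convergence.
  have : Tendsto (fun n => cderiv r (f n) c) atTop (𝓝 (cderiv r g c)) := by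
    refine Tendsto.const_smul ?_ _
    unfold circleIntegral
    refine intervalIntegral.tendsto_integral_filter_of_dominated_convergence
      (fun _ => |r| * ((r ^ 2)⁻¹ * M)) ?_ ?_ (by simp) ?_
    · filter_upwards [hf] with n hn
      refine Continuous.aestronglyMeasurable ?_
      simp only [deriv_circleMap]
      have h0 : ∀ θ, (circleMap c r θ - c) ^ 2 ≠ 0 := fun θ =>
        pow_ne_zero _ (sub_ne_zero.mpr (circleMap_ne_center hr.ne'))
      have h1 : Continuous fun θ => f n (circleMap c r θ) :=
        (hn.continuousOn.mono hsub).comp_continuous (continuous_circleMap c r) hsph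
      have h2 : Continuous (circleMap c r) := continuous_circleMap c r
      have h3 : Continuous (circleMap 0 r) := continuous_circleMap 0 r
      have h4 : Continuous fun θ => ((circleMap c r θ - c) ^ 2)⁻¹ :=
        Continuous.inv₀ (by fun_prop) h0
      simp only [smul_eq_mul]
      exact (h3.mul continuous_const).mul (h4.mul h1)
    · filter_upwards [hM] with n hn
      refine Eventually.of_forall fun θ _ => ?_
      have := hn _ (hsph θ)
      rw [norm_smul, norm_smul, deriv_circleMap, norm_mul, norm_inv, norm_pow, norm_circleMap_zero,
        norm_I, mul_one, circleMap_sub_center, norm_circleMap_zero, sq_abs]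
      gcongr
    · refine Eventually.of_forall fun θ _ => ?_
      exact ((hlim _ (hsub (hsph θ))).const_smul _).const_smul _
  refine this.congr' ?_
  filter_upwards [hf] with n hn
  exact cderiv_eq_deriv hU hn hr hc

theorem differentiableOn_GammaSeq {n : ℕ} (hn : n ≠ 0) :
    DifferentiableOn ℂ (fun s => GammaSeq s n) {s | 0 < s.re} := by
  intro s hs
  have hs : 0 < s.re := hs
  unfold GammaSeq
  refine DifferentiableAt.differentiableWithinAt (DifferentiableAt.div ?_ ?_ ?_)
  · refine DifferentiableAt.mul_const ?_ _
    exact differentiableAt_id.const_cpow (Or.inl (Nat.cast_ne_zero.mpr hn))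
  · fun_prop
  · refine Finset.prod_ne_zero_iff.mpr fun j _ h => ?_
    have := congrArg re h
    simp at this
    have : (0:ℝ) ≤ j := by positivity
    linarith

theorem logDeriv_GammaSeq {s : ℂ} (hs : 0 < s.re) {n : ℕ} (hn : n ≠ 0) :
    logDeriv (fun s => GammaSeq s n) s =
      Complex.log n - ∑ k ∈ Finset.range (n + 1), 1 / (s + k) := by
  have hne : ∀ j : ℕ, s + j ≠ 0 := fun j h => by
    have := congrArg re h
    simp at this
    have : (0:ℝ) ≤ j := by positivity
    linarith
  have hn' : (n : ℂ) ≠ 0 := Nat.cast_ne_zero.mpr hn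
  have hfac : (n.factorial : ℂ) ≠ 0 := Nat.cast_ne_zero.mpr n.factorial_ne_zero
  have hd : DifferentiableAt ℂ (fun s : ℂ => (n : ℂ) ^ s) s :=
    differentiableAt_id.const_cpow (Or.inl hn')
  have hcp : (n : ℂ) ^ s ≠ 0 := by simp [cpow_eq_zero_iff, hn]
  unfold GammaSeq
  rw [logDeriv_div (f := fun s : ℂ => (n : ℂ) ^ s * (n.factorial : ℂ))
    (g := fun s : ℂ => ∏ j ∈ Finset.range (n + 1), (s + j)) s
    (mul_ne_zero hcp hfac) (Finset.prod_ne_zero_iff.mpr fun j _ => hne j)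
    (hd.mul_const _) (by fun_prop), logDeriv_mul_const _ _ hfac]
  congr 1
  · have h := ((hasDerivAt_id s).const_cpow (Or.inl hn')).deriv
    simp only [id] at h
    rw [logDeriv_apply, h]
    field_simp
  · rw [logDeriv_prod (fun j _ => hne j) (fun j _ => by fun_prop)]
    refine Finset.sum_congr rfl fun j _ => ?_
    rw [logDeriv_apply]
    simp

/-- The digamma function as a limit, on the right half plane. -/
theorem tendsto_log_sub_sum_digamma {s : ℂ} (hs : 0 < s.re) :
    Tendsto (fun n : ℕ => Complex.log n - ∑ k ∈ Finset.range (n + 1), 1 / (s + k)) atTop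
      (𝓝 (digamma s)) := by
  have hU : IsOpen {s : ℂ | 0 < s.re} := isOpen_lt continuous_const continuous_re
  have hball : Metric.closedBall s (s.re / 2) ⊆ {s : ℂ | 0 < s.re} := by
    intro w hw
    have h1 : ‖w - s‖ ≤ s.re / 2 := by simpa [dist_eq_norm] using hw
    have h2 := (abs_le.mp (abs_re_le_norm (w - s))).1
    simp only [sub_re] at h2
    show 0 < w.re
    linarith
  have hGd : DifferentiableOn ℂ Gamma {s : ℂ | 0 < s.re} := fun w hw =>
    (differentiableAt_Gamma w fun m h => by
      have h0 : 0 < w.re := hw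
      have := congrArg re h
      simp at this
      have : (0:ℝ) ≤ m := by positivity
      linarith).differentiableWithinAt
  have hcont : ContinuousOn (fun w : ℂ => Real.Gamma w.re) (Metric.closedBall s (s.re / 2)) := by
    intro w hw
    have h0 : 0 < w.re := hball hw
    have := (Real.differentiableAt_Gamma (s := w.re) fun m h => by
      have : (0:ℝ) ≤ m := by positivity
      linarith).continuousAt
    exact (ContinuousAt.comp (f := re) this continuous_re.continuousAt).continuousWithinAt
  obtain ⟨M, hM⟩ := (isCompact_closedBall s (s.re / 2)).bddAbove_image hcont
  have hder := tendsto_deriv_of_dominated_on_circle (f := fun n s => GammaSeq s n) (g := Gamma)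
    hU (half_pos hs) hball
    ((eventually_ne_atTop 0).mono fun n hn => differentiableOn_GammaSeq hn) hGd (M := M)
    ((eventually_ne_atTop 0).mono fun n hn w hw => by
      have hw' := Metric.sphere_subset_closedBall hw
      exact (norm_GammaSeq_le_Gamma_re (hball hw') hn).trans (hM ⟨w, hw', rfl⟩))
    (fun w _ => GammaSeq_tendsto_Gamma w)
  have := hder.div (GammaSeq_tendsto_Gamma s) (Gamma_ne_zero_of_re_pos hs)
  refine this.congr' ?_
  filter_upwards [eventually_ne_atTop 0] with n hn
  rw [← logDeriv_GammaSeq hs hn, logDeriv_apply, Pi.div_apply]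

theorem tendsto_sum_im_digamma {σ y : ℝ} (hσ : 0 < σ) :
    Tendsto (fun n : ℕ => ∑ k ∈ Finset.range (n + 1), y / ((σ + k) ^ 2 + y ^ 2)) atTop
      (𝓝 (digamma (σ + y * I)).im) := by
  have h := (continuous_im.tendsto _).comp
    (tendsto_log_sub_sum_digamma (s := σ + y * I) (by simpa using hσ))
  refine h.congr fun n => ?_
  simp only [Function.comp_apply, sub_im, im_sum]
  rw [← ofReal_natCast n, ← ofReal_log (by positivity), ofReal_im, zero_sub, ← Finset.sum_neg_distrib]
  refine Finset.sum_congr rfl fun k _ => ?_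
  rw [one_div, inv_im]
  simp [normSq_apply]
  ring

theorem tendsto_sum_re_digamma {σ y : ℝ} (hσ : 0 < σ) :
    Tendsto (fun n : ℕ => Real.log n -
      ∑ k ∈ Finset.range (n + 1), (σ + k) / ((σ + k) ^ 2 + y ^ 2)) atTop
      (𝓝 (digamma (σ + y * I)).re) := by
  have h := (continuous_re.tendsto _).comp
    (tendsto_log_sub_sum_digamma (s := σ + y * I) (by simpa using hσ))
  refine h.congr fun n => ?_
  simp only [Function.comp_apply, sub_re, re_sum]
  rw [← ofReal_natCast n, ← ofReal_log (by positivity), ofReal_re]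
  congr 1
  refine Finset.sum_congr rfl fun k _ => ?_
  rw [one_div, inv_re]
  simp [normSq_apply]
  ring

theorem _root_.Real.arctan_sub_arctan_le {a b : ℝ} (ha : 0 ≤ a) (hab : a < b) :
    Real.arctan b - Real.arctan a ≤ (b - a) / (1 + a ^ 2) ∧
      (b - a) / (1 + b ^ 2) ≤ Real.arctan b - Real.arctan a := by
  obtain ⟨c, hc, h⟩ := exists_deriv_eq_slope Real.arctan hab Real.continuous_arctan.continuousOn
    Real.differentiable_arctan.differentiableOn
  have hba : 0 < b - a := sub_pos.mpr hab
  rw [Real.deriv_arctan, eq_div_iff hba.ne'] at h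
  rw [← h, div_eq_mul_one_div, div_eq_mul_one_div (b - a) (1 + b ^ 2), mul_comm (1 / (1 + c ^ 2))]
  have h1 := hc.1
  have h2 := hc.2
  constructor <;> gcongr
  all_goals linarith

/-- The series ∑ y/((σ+k)²+y²) is compared with the increments of arctan((σ+k)/y), which telescope
to π/2 - arctan(σ/y). The upper bound compares each increment with the next term of the series; the
leftover term k = 0 costs at most 1/y. -/
theorem im_digamma_bounds {σ y : ℝ} (hσ : 0 < σ) (hy : 0 < y) :
    Real.pi / 2 - Real.arctan (σ / y) ≤ (digamma (σ + y * I)).im ∧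
      (digamma (σ + y * I)).im ≤ Real.pi / 2 - Real.arctan (σ / y) + 1 / y := by
  set g : ℕ → ℝ := fun k => Real.arctan ((σ + k) / y) with hg
  have hdiff : ∀ k : ℕ, (σ + (k + 1 : ℕ)) / y - (σ + k) / y = 1 / y := fun k => by
    push_cast; ring
  have hkey : ∀ k : ℕ, g (k + 1) - g k ≤ y / ((σ + k) ^ 2 + y ^ 2) ∧
      y / ((σ + (k + 1 : ℕ)) ^ 2 + y ^ 2) ≤ g (k + 1) - g k := fun k => by
    have h := Real.arctan_sub_arctan_le (a := (σ + k) / y) (b := (σ + (k + 1 : ℕ)) / y)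
      (by positivity) (by rw [← sub_pos, hdiff]; positivity)
    rw [hdiff] at h
    refine ⟨h.1.trans (le_of_eq ?_), le_trans (le_of_eq ?_) h.2⟩
    · field_simp
      ring
    · field_simp
      ring
  have hglim : Tendsto g atTop (𝓝 (Real.pi / 2)) := by
    refine (Real.tendsto_arctan_atTop.mono_right nhdsWithin_le_nhds).comp ?_
    exact (tendsto_atTop_add_const_left _ _ tendsto_natCast_atTop_atTop).atTop_div_const hy
  have hg0 : g 0 = Real.arctan (σ / y) := by simp [hg]
  have hlim := tendsto_sum_im_digamma (y := y) hσ
  rw [← hg0]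
  constructor
  · refine le_of_tendsto_of_tendsto ((hglim.comp (tendsto_add_atTop_nat 1)).sub_const (g 0)) hlim
      (Eventually.of_forall fun n => ?_)
    simp only [Function.comp_apply]
    rw [← Finset.sum_range_sub]
    exact Finset.sum_le_sum fun k _ => (hkey k).1
  · refine le_of_tendsto_of_tendsto hlim ((hglim.sub_const (g 0)).add_const (1 / y))
      (Eventually.of_forall fun n => ?_)
    simp only
    rw [Finset.sum_range_succ', ← Finset.sum_range_sub]
    refine add_le_add (Finset.sum_le_sum fun k _ => (hkey k).2) ?_
    rw [div_le_div_iff₀ (by positivity) hy]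
    nlinarith [sq_nonneg (σ + ((0 : ℕ) : ℝ))]

theorem tendsto_im_digamma {σ : ℝ} (hσ : 0 < σ) :
    Tendsto (fun y : ℝ => (digamma (σ + y * I)).im) atTop (𝓝 (Real.pi / 2)) := by
  have h1 : Tendsto (fun y : ℝ => Real.pi / 2 - Real.arctan (σ / y)) atTop (𝓝 (Real.pi / 2)) := by
    have := (Real.continuous_arctan.tendsto 0).comp
      (tendsto_const_nhds.div_atTop (a := σ) tendsto_id)
    simpa using tendsto_const_nhds.sub this
  have h2 : Tendsto (fun y : ℝ => Real.pi / 2 - Real.arctan (σ / y) + 1 / y) atTop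
      (𝓝 (Real.pi / 2)) := by
    simpa using h1.add (tendsto_const_nhds.div_atTop (a := (1 : ℝ)) tendsto_id)
  refine tendsto_of_tendsto_of_tendsto_of_le_of_le' h1 h2 ?_ ?_
  · filter_upwards [eventually_gt_atTop 0] with y hy using (im_digamma_bounds hσ hy).1
  · filter_upwards [eventually_gt_atTop 0] with y hy using (im_digamma_bounds hσ hy).2

/-- Passing from height 0 to height y raises the k-th term by y²/((1+k)((1+k)²+y²)), which is at
least half of 1/(k+1) as soon as k+1 ≤ y. The divergence of the harmonic series then gives growth.
-/
theorem re_digamma_one_add_ge (N : ℕ) {y : ℝ} (hy : N ≤ y) :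
    (digamma 1).re + (1 / 2) * ∑ k ∈ Finset.range N, 1 / ((k : ℝ) + 1) ≤
      (digamma (1 + y * I)).re := by
  have h0 := tendsto_sum_re_digamma (σ := 1) (y := 0) one_pos
  have h1 := tendsto_sum_re_digamma (σ := 1) (y := y) one_pos
  simp only [ofReal_one, ofReal_zero, zero_mul, add_zero] at h0 h1
  refine le_of_tendsto_of_tendsto (h0.add_const _) h1 ?_
  filter_upwards [eventually_ge_atTop N] with n hn
  have hsplit : ∑ k ∈ Finset.range N, (1 / 2) * (1 / ((k : ℝ) + 1)) ≤
      ∑ k ∈ Finset.range (n + 1), ((1 + (k : ℝ)) / ((1 + k) ^ 2 + 0 ^ 2) -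
        (1 + (k : ℝ)) / ((1 + k) ^ 2 + y ^ 2)) := by
    refine (Finset.sum_le_sum fun k hk => ?_).trans
      (Finset.sum_le_sum_of_subset_of_nonneg
        (Finset.range_mono (by omega : N ≤ n + 1)) fun k _ _ => ?_)
    · have hky : 1 + (k : ℝ) ≤ y := by
        have : k + 1 ≤ N := Finset.mem_range.mp hk
        have : ((k + 1 : ℕ) : ℝ) ≤ N := by exact_mod_cast this
        push_cast at this
        linarith
      have hk0 : (0 : ℝ) < 1 + k := by positivity
      rw [div_sub_div _ _ (by positivity) (by positivity), ← mul_div_mul_left _ _ two_ne_zero,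
        div_mul_div_comm, div_le_div_iff₀ (by positivity) (by positivity)]
      have : (1 + (k : ℝ)) ^ 2 ≤ y ^ 2 := by gcongr
      nlinarith [mul_nonneg (pow_pos hk0 2).le (sub_nonneg.mpr this), pow_pos hk0 3]
    · rw [sub_nonneg]
      refine div_le_div_of_nonneg_left (by positivity) (by positivity) ?_
      nlinarith [sq_nonneg y]
  rw [Finset.sum_sub_distrib, ← Finset.mul_sum] at hsplit
  linarith

theorem tendsto_re_digamma_one_add :
    Tendsto (fun y : ℝ => (digamma (1 + y * I)).re) atTop atTop := by
  refine tendsto_atTop.mpr fun b => ?_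
  have h := tendsto_atTop_add_const_left _ (digamma 1).re
    (Tendsto.const_mul_atTop (one_half_pos (α := ℝ)) Real.tendsto_sum_range_one_div_nat_succ_atTop)
  obtain ⟨N, hN⟩ := (h.eventually_ge_atTop b).exists
  filter_upwards [eventually_ge_atTop (N : ℝ)] with y hy
  exact hN.trans (re_digamma_one_add_ge N hy)

end Complex

/-! ### Partial fractions of the logarithmic derivative of an entire function -/

namespace Complex

/-- If a zero-free holomorphic function on a disk of radius `R` is bounded by `exp M` times its
value at the center, then its logarithmic derivative varies slowly near the center. -/
theorem norm_logDeriv_sub_logDeriv_le {G : ℂ → ℂ} {R M : ℝ} (hR : 0 < R) (hM : 0 < M)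
    (hG : DifferentiableOn ℂ G (Metric.ball 0 R)) (hne : ∀ z ∈ Metric.ball (0 : ℂ) R, G z ≠ 0)
    (hb : ∀ z ∈ Metric.ball (0 : ℂ) R, ‖G z‖ ≤ Real.exp M * ‖G 0‖) {w : ℂ} (hw : ‖w‖ < R / 4) :
    ‖logDeriv G w - logDeriv G 0‖ ≤ 64 * M / R ^ 2 * ‖w‖ := by
  have h0 : (0 : ℂ) ∈ Metric.ball (0 : ℂ) R := Metric.mem_ball_self hR
  have hL : DifferentiableOn ℂ (logDeriv G) (Metric.ball 0 R) :=
    (hG.deriv Metric.isOpen_ball).div hG hne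
  -- `h` is a holomorphic logarithm of G/G(0) on the disk; the growth hypothesis becomes Re h ≤ M.
  obtain ⟨h, hh0, hh⟩ := hL.isExactOn_ball.with_val_at 0 0
  have hhd : DifferentiableOn ℂ h (Metric.ball 0 R) := fun z hz =>
    (hh z hz).differentiableAt.differentiableWithinAt
  have hexp : ∀ z ∈ Metric.ball (0 : ℂ) R, G z = G 0 * exp (h z) := by
    intro z hz
    have hconst := Metric.isOpen_ball.is_const_of_deriv_eq_zero (𝕜 := ℂ)
      (f := fun z => G z * exp (-h z)) (convex_ball (0 : ℂ) R).isPreconnected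
      (hG.mul (hhd.neg.cexp)) (fun x hx => by
        have hGx : HasDerivAt G (deriv G x) x :=
          ((hG x hx).differentiableAt (Metric.isOpen_ball.mem_nhds hx)).hasDerivAt
        have := (hGx.mul (hh x hx).neg.cexp).deriv
        simp only [Pi.mul_def, Pi.neg_apply] at this
        rw [this, logDeriv_apply]
        field_simp [hne x hx]
        simp) hz h0
    simp only [hh0, neg_zero, exp_zero, mul_one] at hconst
    rw [← hconst, mul_assoc, ← exp_add]
    simp
  have hre : Set.MapsTo h (Metric.ball 0 R) {z | z.re ≤ M} := by
    intro z hz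
    have h1 := hb z hz
    rw [hexp z hz, norm_mul, norm_exp, mul_comm] at h1
    exact Real.exp_le_exp.mp (le_of_mul_le_mul_right h1 (norm_pos_iff.mpr (hne 0 h0)))
  -- Borel–Carathéodory bounds h by 2M on the half disk, Cauchy's estimate on circles of radius R/4
  -- then bounds h' by 8M/R, and the Schwarz lemma on radius R/4 turns an oscillation of 16M/R into
  -- the slope 64M/R².
  have hhalf : ∀ z : ℂ, ‖z‖ ≤ R / 2 → ‖h z‖ ≤ 2 * M := by
    intro z hz
    refine (borelCaratheodory_zero hM hhd hre hR
      (mem_ball_zero_iff.mpr (by linarith)) hh0).trans ?_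
    rw [div_le_iff₀ (by linarith)]
    nlinarith
  have hquarter : ∀ z : ℂ, ‖z‖ < R / 4 → ‖logDeriv G z‖ ≤ 8 * M / R := by
    intro z hz
    have hzR : z ∈ Metric.ball (0 : ℂ) R := mem_ball_zero_iff.mpr (by linarith)
    have hsub : Metric.closedBall z (R / 4) ⊆ Metric.closedBall 0 (R / 2) :=
      Metric.closedBall_subset_closedBall' (by rw [dist_zero_right]; linarith)
    have hsub' : Metric.closedBall (0 : ℂ) (R / 2) ⊆ Metric.ball 0 R :=
      Metric.closedBall_subset_ball (by linarith)
    have := norm_deriv_le_of_forall_mem_sphere_norm_le (c := z) (R := R / 4) (f := h)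
      (C := 2 * M) (by positivity) ((hhd.mono (hsub.trans hsub')).diffContOnCl_ball subset_rfl)
      (fun x hx => hhalf x
        (mem_closedBall_zero_iff.mp (hsub (Metric.sphere_subset_closedBall hx))))
    rw [(hh z hzR).deriv] at this
    refine this.trans (le_of_eq ?_)
    field_simp
    norm_num
  have hS := dist_le_div_mul_dist_of_mapsTo_ball (f := logDeriv G) (c := 0) (R₁ := R / 4)
    (R₂ := 16 * M / R) (hL.mono (Metric.ball_subset_ball (by linarith)))
    (fun z hz => by
      rw [Metric.mem_closedBall, dist_eq_norm]
      refine (norm_sub_le _ _).trans ?_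
      have h1 := hquarter z (mem_ball_zero_iff.mp hz)
      have h2 := hquarter 0 (by simp; positivity)
      calc _ ≤ 8 * M / R + 8 * M / R := add_le_add h1 h2
        _ = 16 * M / R := by ring) (mem_ball_zero_iff.mpr hw)
  rw [dist_eq_norm, dist_zero_right] at hS
  refine hS.trans (le_of_eq ?_)
  field_simp
  ring

/-- Division of an entire function by its zero at a point. -/
theorem exists_differentiable_eq_pow_mul {F : ℂ → ℂ} (hF : Differentiable ℂ F) {a : ℂ}
    (ha : analyticOrderAt F a ≠ ⊤) :
    ∃ G : ℂ → ℂ, Differentiable ℂ G ∧ G a ≠ 0 ∧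
      ∀ z, F z = (z - a) ^ analyticOrderNatAt F a * G z := by
  obtain ⟨g, hg, hga, hgF⟩ := (hF.analyticAt a).analyticOrderAt_ne_top.mp ha
  set m := analyticOrderNatAt F a
  set G : ℂ → ℂ := Function.update (fun z => F z / (z - a) ^ m) a (g a) with hGdef
  have hGne : ∀ z, z ≠ a → G z = F z / (z - a) ^ m := fun z hz => by
    simp [hGdef, Function.update_of_ne hz]
  have hGa : G a = g a := by simp [hGdef]
  have hGg : G =ᶠ[𝓝 a] g := by
    filter_upwards [hgF] with z hz
    rcases eq_or_ne z a with rfl | hza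
    · exact hGa
    · rw [hGne z hza, hz, smul_eq_mul,
        mul_div_cancel_left₀ _ (pow_ne_zero _ (sub_ne_zero.mpr hza))]
  refine ⟨G, fun z => ?_, hGa ▸ hga, fun z => ?_⟩
  · rcases eq_or_ne z a with rfl | hza
    · exact hg.differentiableAt.congr_of_eventuallyEq hGg
    · have : G =ᶠ[𝓝 z] fun z => F z / (z - a) ^ m := by
        filter_upwards [isOpen_ne.mem_nhds hza] with x hx using hGne x hx
      refine DifferentiableAt.congr_of_eventuallyEq ?_ this
      exact hF.differentiableAt.div (by fun_prop) (pow_ne_zero _ (sub_ne_zero.mpr hza))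
  · rcases eq_or_ne z a with rfl | hza
    · rw [hGa]
      exact hgF.self_of_nhds
    · rw [hGne z hza, mul_div_cancel₀ _ (pow_ne_zero _ (sub_ne_zero.mpr hza))]

/-- Division of an entire function by finitely many of its zeros. -/
theorem exists_differentiable_eq_prod_pow_mul {F : ℂ → ℂ} (hF : Differentiable ℂ F)
    (hord : ∀ a, analyticOrderAt F a ≠ ⊤) (S : Finset ℂ) :
    ∃ G : ℂ → ℂ, Differentiable ℂ G ∧ (∀ a ∈ S, G a ≠ 0) ∧
      ∀ z, F z = (∏ a ∈ S, (z - a) ^ analyticOrderNatAt F a) * G z := by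
  induction S using Finset.induction_on with
  | empty => exact ⟨F, hF, by simp, by simp⟩
  | insert a S haS ih =>
    obtain ⟨G, hG, hGS, hFG⟩ := ih
    set P : ℂ → ℂ := fun z => ∏ a ∈ S, (z - a) ^ analyticOrderNatAt F a with hP
    have hPd : Differentiable ℂ P := by fun_prop
    have hPa : P a ≠ 0 := Finset.prod_ne_zero_iff.mpr fun b hb =>
      pow_ne_zero _ (sub_ne_zero.mpr fun h => haS (h ▸ hb))
    have hFeq : F = P * G := funext hFG
    -- The factors already removed do not vanish at the new point, so the order of `F` there is
    -- still carried by `G`.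
    have hordG : analyticOrderAt F a = analyticOrderAt G a := by
      conv_lhs => rw [hFeq]
      rw [analyticOrderAt_mul (hPd.analyticAt a) (hG.analyticAt a),
        analyticOrderAt_eq_zero.mpr (Or.inr hPa), zero_add]
    obtain ⟨H, hH, hHa, hGH⟩ := exists_differentiable_eq_pow_mul hG (hordG ▸ hord a)
    refine ⟨H, hH, fun b hb => ?_, fun z => ?_⟩
    · rcases Finset.mem_insert.mp hb with rfl | hb
      · exact hHa
      · have := hGS b hb
        rw [hGH] at this
        exact right_ne_zero_of_mul this
    · rw [Finset.prod_insert haS, hFG z, hGH z]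
      simp only [analyticOrderNatAt, hordG]
      ring

theorem analyticOrderAt_ne_top_of_differentiable {F : ℂ → ℂ} (hF : Differentiable ℂ F) {c : ℂ}
    (hc : F c ≠ 0) (a : ℂ) : analyticOrderAt F a ≠ ⊤ := by
  refine AnalyticOnNhd.analyticOrderAt_ne_top_of_isPreconnected (U := Set.univ) (x := c)
    (fun z _ => hF.analyticAt z) isPreconnected_univ (Set.mem_univ _) (Set.mem_univ _) ?_
  rw [analyticOrderAt_eq_zero.mpr (Or.inr hc)]
  simp

/-- A quantitative form of Hadamard's partial fraction expansion of the logarithmic derivative. -/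
theorem norm_logDeriv_sub_sum_le {F : ℂ → ℂ} (hF : Differentiable ℂ F) (h0 : F 0 ≠ 0) {R M : ℝ}
    (hR : 0 < R) (hM : 0 < M) (hb : ∀ z : ℂ, ‖z‖ = 2 * R → ‖F z‖ ≤ Real.exp M * ‖F 0‖)
    {S : Finset ℂ} (hS : ∀ z, z ∈ S ↔ F z = 0 ∧ ‖z‖ ≤ R) {w : ℂ} (hw : ‖w‖ < R / 4)
    (hFw : F w ≠ 0) :
    ‖logDeriv F w - logDeriv F 0 -
      ∑ a ∈ S, (analyticOrderNatAt F a : ℂ) * (1 / (w - a) + 1 / a)‖ ≤ 64 * M / R ^ 2 * ‖w‖ := by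
  obtain ⟨G, hG, hGS, hFG⟩ := exists_differentiable_eq_prod_pow_mul hF
    (analyticOrderAt_ne_top_of_differentiable hF h0) S
  set m : ℂ → ℕ := fun a => analyticOrderNatAt F a
  have hlog : ∀ z, F z ≠ 0 → logDeriv F z = ∑ a ∈ S, (m a : ℂ) * (1 / (z - a)) + logDeriv G z := by
    intro z hz
    have hz' := hz
    rw [hFG z] at hz'
    have hne : ∀ a ∈ S, (z - a) ^ m a ≠ 0 :=
      Finset.prod_ne_zero_iff.mp (left_ne_zero_of_mul hz')
    have hF' : F = fun z => (∏ a ∈ S, (z - a) ^ m a) * G z := funext hFG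
    rw [hF', logDeriv_mul (f := fun z => ∏ a ∈ S, (z - a) ^ m a) z (left_ne_zero_of_mul hz')
      (right_ne_zero_of_mul hz') (by fun_prop) hG.differentiableAt,
      logDeriv_prod hne (fun a _ => by fun_prop)]
    congr 1
    refine Finset.sum_congr rfl fun a _ => ?_
    rw [logDeriv_fun_pow (by fun_prop), logDeriv_apply]
    simp
  have hGne : ∀ z ∈ Metric.ball (0 : ℂ) R, G z ≠ 0 := by
    intro z hz
    by_cases hz0 : F z = 0
    · exact hGS z ((hS z).mpr ⟨hz0, (mem_ball_zero_iff.mp hz).le⟩)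
    · rw [hFG z] at hz0
      exact right_ne_zero_of_mul hz0
  have hsphere : ∀ z : ℂ, ‖z‖ = 2 * R → ‖G z‖ ≤ Real.exp M * ‖G 0‖ := by
    intro z hz
    -- On the circle of radius 2R each |z-a| is at least R ≥ |a|, so dividing out the zeros only
    -- improves the bound relative to the center; the maximum principle carries it inward.
    have hfac : ∀ a ∈ S, ‖(0 - a) ^ m a‖ ≤ ‖(z - a) ^ m a‖ := by
      intro a ha
      rw [norm_pow, norm_pow]
      have := ((hS a).mp ha).2
      have h1 := norm_sub_norm_le z a
      gcongr
      rw [zero_sub, norm_neg]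
      linarith
    have hprod : ‖∏ a ∈ S, (0 - a) ^ m a‖ ≤ ‖∏ a ∈ S, (z - a) ^ m a‖ := by
      rw [norm_prod, norm_prod]
      exact Finset.prod_le_prod (fun _ _ => norm_nonneg _) hfac
    have h1 := hb z hz
    rw [hFG z, hFG 0, norm_mul, norm_mul] at h1
    have hpos : 0 < ‖∏ a ∈ S, (0 - a) ^ m a‖ := by
      rw [hFG 0] at h0
      exact norm_pos_iff.mpr (left_ne_zero_of_mul h0)
    have h2 : ‖∏ a ∈ S, (0 - a) ^ m a‖ * ‖G z‖ ≤
        ‖∏ a ∈ S, (0 - a) ^ m a‖ * (Real.exp M * ‖G 0‖) := by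
      calc _ ≤ _ := mul_le_mul_of_nonneg_right hprod (norm_nonneg (G z))
        _ ≤ _ := h1
        _ = _ := by ring
    exact le_of_mul_le_mul_left h2 hpos
  have hbG : ∀ z ∈ Metric.ball (0 : ℂ) R, ‖G z‖ ≤ Real.exp M * ‖G 0‖ := by
    intro z hz
    have hR2 : (0 : ℝ) ≠ 2 * R := by positivity
    refine norm_le_of_forall_mem_frontier_norm_le (U := Metric.ball 0 (2 * R))
      Metric.isBounded_ball hG.diffContOnCl (fun x hx => hsphere x ?_) (subset_closure ?_)
    · rw [frontier_ball _ hR2.symm] at hx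
      exact mem_sphere_zero_iff_norm.mp hx
    · exact Metric.ball_subset_ball (by linarith) hz
  have := norm_logDeriv_sub_logDeriv_le hR hM hG.differentiableOn hGne hbG hw
  convert this using 2
  rw [hlog w hFw, hlog 0 h0]
  simp only [mul_add, Finset.sum_add_distrib]
  have : ∑ a ∈ S, (m a : ℂ) * (1 / (0 - a)) = - ∑ a ∈ S, (m a : ℂ) * (1 / a) := by
    rw [← Finset.sum_neg_distrib]
    refine Finset.sum_congr rfl fun a _ => ?_
    rw [zero_sub, one_div_neg_eq_neg_one_div, mul_neg]
  rw [this]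
  ring

/-- Partial fraction expansion of the logarithmic derivative of an entire function of order less
than two. -/
theorem tendsto_sum_logDeriv {F : ℂ → ℂ} (hF : Differentiable ℂ F) (h0 : F 0 ≠ 0) {B : ℝ → ℝ}
    (hB : Tendsto (fun r => B r / r ^ 2) atTop (𝓝 0)) (hb : ∀ z, ‖F z‖ ≤ Real.exp (B ‖z‖))
    {S : ℕ → Finset ℂ} (hS : ∀ n z, z ∈ S n ↔ F z = 0 ∧ ‖z‖ ≤ n) {w : ℂ} (hFw : F w ≠ 0) :
    Tendsto (fun n => ∑ a ∈ S n, (analyticOrderNatAt F a : ℂ) * (1 / (w - a) + 1 / a)) atTop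
      (𝓝 (logDeriv F w - logDeriv F 0)) := by
  have h2n : Tendsto (fun n : ℕ => 2 * (n : ℝ)) atTop atTop :=
    tendsto_natCast_atTop_atTop.const_mul_atTop two_pos
  set K : ℝ := |Real.log ‖F 0‖| + 1
  set M : ℕ → ℝ := fun n => |B (2 * n)| + K
  have hMpos : ∀ n, 0 < M n := fun n => by positivity
  have hMlim : Tendsto (fun n : ℕ => 64 * M n / (n : ℝ) ^ 2 * ‖w‖) atTop (𝓝 0) := by
    have h1 := (hB.comp h2n).abs
    have h2 : Tendsto (fun n : ℕ => K / (n : ℝ) ^ 2) atTop (𝓝 0) :=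
      tendsto_const_nhds.div_atTop
        ((tendsto_pow_atTop two_ne_zero).comp tendsto_natCast_atTop_atTop)
    -- The factor 4 converts B(2n)/(2n)² into B(2n)/n².
    have h3 := ((h1.const_mul 4).add h2).const_mul (64 * ‖w‖)
    simp only [abs_zero, mul_zero, add_zero] at h3
    refine h3.congr fun n => ?_
    simp only [Function.comp_apply, M, abs_div, abs_pow, abs_mul, Nat.abs_cast, abs_two]
    rw [mul_pow, ← div_div]
    ring
  rw [tendsto_iff_norm_sub_tendsto_zero]
  refine squeeze_zero' (Eventually.of_forall fun _ => norm_nonneg _) ?_ hMlim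
  have hlarge : ∀ᶠ n : ℕ in atTop, 4 * ‖w‖ + 1 ≤ n :=
    tendsto_natCast_atTop_atTop.eventually_ge_atTop _
  filter_upwards [hlarge] with n hn
  have hn0 : (0 : ℝ) < n := by linarith [norm_nonneg w]
  rw [norm_sub_rev]
  refine norm_logDeriv_sub_sum_le hF h0 hn0 (hMpos n) (fun z hz => ?_) (hS n) (by linarith) hFw
  refine (hb z).trans ?_
  have hF0 := norm_pos_iff.mpr h0
  rw [← Real.exp_log hF0, hz, ← Real.exp_add, Real.exp_le_exp]
  have := le_abs_self (B (2 * n))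
  have := neg_abs_le (Real.log ‖F 0‖)
  simp only [M, K]
  linarith

end Complex

/-! ### Growth of the completed zeta function -/

open MeasureTheory in
theorem exists_norm_mellin_le {f : ℝ → ℂ} {a b : ℝ} (ha : MellinConvergent f a)
    (hb : MellinConvergent f b) :
    ∃ C, ∀ s : ℂ, a ≤ s.re → s.re ≤ b → ‖mellin f s‖ ≤ C := by
  refine ⟨_, fun s has hsb => norm_integral_le_of_norm_le (ha.norm.add hb.norm) ?_⟩
  refine (ae_restrict_iff' measurableSet_Ioi).mpr (Eventually.of_forall fun t ht => ?_)
  have ht : 0 < t := ht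
  simp only [Pi.add_apply, norm_smul, Complex.norm_cpow_eq_rpow_re_of_pos ht, Complex.sub_re,
    Complex.one_re, Complex.ofReal_re]
  rw [← add_mul]
  refine mul_le_mul_of_nonneg_right ?_ (norm_nonneg _)
  -- The kernel t^(Re s - 1) is at most its value at exponent b for t ≥ 1 and at exponent a for t ≤
  -- 1, so the sum of the two endpoint integrands dominates.
  rcases le_total 1 t with h1 | h1
  · exact (Real.rpow_le_rpow_of_exponent_le h1 (by linarith)).trans
      (le_add_of_nonneg_left (by positivity))
  · exact (Real.rpow_le_rpow_of_exponent_ge ht h1 (by linarith)).trans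
      (le_add_of_nonneg_right (by positivity))

theorem Complex.norm_Gamma_le_Gamma_re {s : ℂ} (hs : 0 < s.re) :
    ‖Complex.Gamma s‖ ≤ Real.Gamma s.re :=
  le_of_tendsto (Complex.GammaSeq_tendsto_Gamma s).norm
    ((eventually_ne_atTop 0).mono fun _ hn => Complex.norm_GammaSeq_le_Gamma_re hs hn)

/-- Up to a factor 1/2 this function is a Mellin transform that converges absolutely at every point,
so it is bounded on each closed vertical strip. -/
theorem exists_norm_completedRiemannZeta₀_le_of_mem_strip (a b : ℝ) :
    ∃ C, ∀ s : ℂ, a ≤ s.re → s.re ≤ b → ‖completedRiemannZeta₀ s‖ ≤ C := by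
  have hconv : ∀ s : ℂ, MellinConvergent (HurwitzZeta.hurwitzEvenFEPair 0).f_modif s := fun s =>
    ((HurwitzZeta.hurwitzEvenFEPair 0).isStrongFEPair_toStrongFEPair.hasMellin s).1
  obtain ⟨C, hC⟩ := exists_norm_mellin_le (hconv (a / 2 : ℝ)) (hconv (b / 2 : ℝ))
  refine ⟨C / 2, fun s has hsb => ?_⟩
  have h2 : (s / 2).re = s.re / 2 := by simp
  have := hC (s / 2) (by rw [h2]; linarith) (by rw [h2]; linarith)
  rw [completedRiemannZeta₀, HurwitzZeta.completedHurwitzZetaEven₀, norm_div]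
  simp only [Complex.norm_ofNat]
  exact div_le_div_of_nonneg_right this two_pos.le

theorem exists_norm_riemannZeta_le_of_two_le_re :
    ∃ C, ∀ s : ℂ, 2 ≤ s.re → ‖riemannZeta s‖ ≤ C := by
  have hsum : Summable fun n : ℕ => 1 / ((n : ℝ) + 1) ^ 2 := by
    exact_mod_cast (summable_nat_add_iff 1).mpr (Real.summable_one_div_nat_pow.mpr one_lt_two)
  refine ⟨∑' n : ℕ, 1 / ((n : ℝ) + 1) ^ 2, fun s hs => ?_⟩
  rw [zeta_eq_tsum_one_div_nat_add_one_cpow (by linarith)]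
  refine tsum_of_norm_bounded hsum.hasSum fun n => ?_
  have hn : (0 : ℝ) < n + 1 := by positivity
  have : ((n : ℂ) + 1) = ((n + 1 : ℝ) : ℂ) := by push_cast; rfl
  rw [norm_div, norm_one, this, Complex.norm_cpow_eq_rpow_re_of_pos hn]
  refine div_le_div_of_nonneg_left zero_le_one (by positivity) ?_
  rw [← Real.rpow_natCast]
  exact Real.rpow_le_rpow_of_exponent_le (by linarith [(Nat.cast_nonneg n : (0:ℝ) ≤ n)])
    (by exact_mod_cast hs)

theorem Real.Gamma_le_exp {x r : ℝ} (hx : 2 ≤ x) (hxr : x + 1 ≤ r) :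
    Real.Gamma x ≤ Real.exp (r * Real.log r) := by
  set n := ⌈x⌉₊
  have h1 : x ≤ n := Nat.le_ceil x
  have h2 : (n : ℝ) ≤ r := (Nat.ceil_lt_add_one (by linarith)).le.trans hxr
  have hn : (0 : ℝ) < n := by linarith
  calc Real.Gamma x ≤ Real.Gamma (n + 1) :=
        Real.Gamma_strictMonoOn_Ici.monotoneOn (Set.mem_Ici.mpr hx)
          (Set.mem_Ici.mpr (by linarith)) (by linarith)
    _ = n.factorial := Real.Gamma_nat_eq_factorial n
    _ ≤ (n : ℝ) ^ n := by exact_mod_cast n.factorial_le_pow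
    _ = Real.exp (n * Real.log n) := by
        rw [mul_comm, ← Real.rpow_def_of_pos hn, Real.rpow_natCast]
    _ ≤ Real.exp (r * Real.log r) := by
        have := Real.log_le_log hn h2
        have := Real.log_nonneg (by linarith : (1 : ℝ) ≤ n)
        have : 0 ≤ r := by linarith
        gcongr

/-- Here ζ is bounded and the growth comes from Γ(s/2). The threshold 4 makes Re s / 2 ≥ 2, where
the real Gamma function is increasing and comparable with a factorial. -/
theorem exists_norm_completedRiemannZeta₀_le_of_four_le_re :
    ∃ C, 0 ≤ C ∧ ∀ s : ℂ, 4 ≤ s.re → ∀ r : ℝ, ‖s‖ + 1 ≤ r →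
      ‖completedRiemannZeta₀ s‖ ≤ C * Real.exp (r * Real.log r) := by
  obtain ⟨C, hC⟩ := exists_norm_riemannZeta_le_of_two_le_re
  have hC0 : 0 ≤ C := (norm_nonneg _).trans (hC 2 (by simp))
  refine ⟨C + 2, by linarith, fun s hs r hr => ?_⟩
  have hns : s.re ≤ ‖s‖ := Complex.re_le_norm s
  have hs0 : s ≠ 0 := fun h => by simp [h] at hs; linarith
  have hG : Complex.Gammaℝ s ≠ 0 := Complex.Gammaℝ_ne_zero_of_re_pos (by linarith)
  have h1 : completedRiemannZeta₀ s = Complex.Gammaℝ s * riemannZeta s + 1 / s + 1 / (1 - s) := by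
    rw [riemannZeta_def_of_ne_zero hs0, mul_div_cancel₀ _ hG, completedRiemannZeta_eq]
    ring
  have hexp : 1 ≤ Real.exp (r * Real.log r) :=
    Real.one_le_exp (mul_nonneg (by linarith) (Real.log_nonneg (by linarith)))
  have h2 : ‖Complex.Gammaℝ s‖ ≤ Real.exp (r * Real.log r) := by
    rw [Complex.Gammaℝ_def, norm_mul, Complex.norm_cpow_eq_rpow_re_of_pos Real.pi_pos]
    have hre : (-s / 2).re = -(s.re / 2) := by simp [neg_div]
    have hre2 : (s / 2).re = s.re / 2 := by simp
    have ha : Real.pi ^ (-s / 2).re ≤ 1 := by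
      rw [hre]
      exact Real.rpow_le_one_of_one_le_of_nonpos (by linarith [Real.pi_gt_three]) (by linarith)
    have hb : ‖Complex.Gamma (s / 2)‖ ≤ Real.exp (r * Real.log r) := by
      refine (Complex.norm_Gamma_le_Gamma_re (by rw [hre2]; linarith)).trans ?_
      rw [hre2]
      exact Real.Gamma_le_exp (by linarith) (by linarith)
    calc _ ≤ 1 * Real.exp (r * Real.log r) :=
          mul_le_mul ha hb (norm_nonneg _) zero_le_one
      _ = _ := one_mul _
  have h3 : ‖1 / s‖ ≤ 1 := by
    rw [norm_div, norm_one]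
    exact div_le_one_of_le₀ (by linarith) (norm_nonneg _)
  have h4 : ‖1 / (1 - s)‖ ≤ 1 := by
    rw [norm_div, norm_one]
    refine div_le_one_of_le₀ ?_ (norm_nonneg _)
    have := Complex.re_le_norm (s - 1)
    rw [norm_sub_rev]
    simp at this
    linarith
  calc ‖completedRiemannZeta₀ s‖ ≤ ‖Complex.Gammaℝ s‖ * ‖riemannZeta s‖ + 1 + 1 := by
        rw [h1, ← norm_mul]
        exact (norm_add_le _ _).trans (add_le_add ((norm_add_le _ _).trans
          (add_le_add_right h3 _)) h4)
    _ ≤ Real.exp (r * Real.log r) * C + 1 + 1 := by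
        gcongr
        exact hC s (by linarith)
    _ ≤ (C + 2) * Real.exp (r * Real.log r) := by linarith

theorem exists_norm_completedRiemannZeta₀_le :
    ∃ C, 0 ≤ C ∧ ∀ s : ℂ, ‖completedRiemannZeta₀ s‖ ≤
      C * Real.exp ((‖s‖ + 2) * Real.log (‖s‖ + 2)) := by
  obtain ⟨C₁, hC₁, h₁⟩ := exists_norm_completedRiemannZeta₀_le_of_four_le_re
  obtain ⟨C₂, h₂⟩ := exists_norm_completedRiemannZeta₀_le_of_mem_strip (-3) 4
  have hC₂ : 0 ≤ C₂ := (norm_nonneg _).trans (h₂ 0 (by simp) (by simp))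
  refine ⟨C₁ + C₂, by positivity, fun s => ?_⟩
  set E := Real.exp ((‖s‖ + 2) * Real.log (‖s‖ + 2))
  have hE : 1 ≤ E := Real.one_le_exp (mul_nonneg (by positivity)
    (Real.log_nonneg (by linarith [norm_nonneg s])))
  have hr : C₁ * E ≤ (C₁ + C₂) * E := by gcongr; linarith
  by_cases h4 : 4 ≤ s.re
  · exact (h₁ s h4 _ (by linarith)).trans hr
  by_cases h3 : -3 ≤ s.re
  · refine (h₂ s h3 (not_le.mp h4).le).trans ?_
    nlinarith
  -- Reflection sends Re s < -3 into Re s > 4; the extra 1 in |1-s| ≤ |s|+1 explains the shift by 2.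
  · rw [← completedRiemannZeta₀_one_sub]
    refine (h₁ (1 - s) (by simp; linarith) (‖s‖ + 2) ?_).trans hr
    have := norm_sub_le 1 s
    rw [norm_one] at this
    linarith

/-! ### The entire function ξ and its zeros -/

noncomputable section

/-- The entire function `s (1 - s) π ^ (-s / 2) Γ(s / 2) ζ(s)`. -/
def riemannXi (s : ℂ) : ℂ := s * (1 - s) * completedRiemannZeta₀ s - 1

end

theorem differentiable_riemannXi : Differentiable ℂ riemannXi := by
  have := differentiable_completedZeta₀
  unfold riemannXi
  fun_prop

theorem riemannXi_one_sub (s : ℂ) : riemannXi (1 - s) = riemannXi s := by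
  rw [riemannXi, riemannXi, completedRiemannZeta₀_one_sub]
  ring

theorem riemannXi_eq_completedRiemannZeta {s : ℂ} (h0 : s ≠ 0) (h1 : s ≠ 1) :
    riemannXi s = s * (1 - s) * completedRiemannZeta s := by
  have h1' : 1 - s ≠ 0 := sub_ne_zero.mpr h1.symm
  rw [riemannXi, completedRiemannZeta_eq]
  field_simp
  ring

theorem riemannXi_eq_riemannZeta {s : ℂ} (hs : 0 < s.re) (h1 : s ≠ 1) :
    riemannXi s = s * (1 - s) * Complex.Gammaℝ s * riemannZeta s := by
  have h0 : s ≠ 0 := fun h => by simp [h] at hs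
  rw [riemannXi_eq_completedRiemannZeta h0 h1, riemannZeta_def_of_ne_zero h0, mul_assoc (s * (1 - s)),
    mul_div_cancel₀ _ (Complex.Gammaℝ_ne_zero_of_re_pos hs)]

theorem riemannXi_one : riemannXi 1 = -1 := by simp [riemannXi]

theorem riemannXi_ne_zero_of_one_le_re {s : ℂ} (hs : 1 ≤ s.re) : riemannXi s ≠ 0 := by
  rcases eq_or_ne s 1 with rfl | h1
  · simp [riemannXi_one]
  have h0 : s ≠ 0 := fun h => by simp [h] at hs; linarith
  rw [riemannXi_eq_riemannZeta (by linarith) h1]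
  exact mul_ne_zero (mul_ne_zero (mul_ne_zero h0 (sub_ne_zero.mpr h1.symm))
    (Complex.Gammaℝ_ne_zero_of_re_pos (by linarith))) (riemannZeta_ne_zero_of_one_le_re hs)

theorem re_pos_of_riemannXi_eq_zero {s : ℂ} (hs : riemannXi s = 0) : 0 < s.re := by
  by_contra h
  rw [← riemannXi_one_sub] at hs
  exact riemannXi_ne_zero_of_one_le_re (by simp; linarith) hs

theorem re_eq_half_of_riemannXi_eq_zero (hRH : RiemannHypothesis) {s : ℂ}
    (hs : riemannXi s = 0) : s.re = 1 / 2 := by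
  have hpos := re_pos_of_riemannXi_eq_zero hs
  have h1 : s ≠ 1 := fun h => by simp [h, riemannXi_one] at hs
  have h0 : s ≠ 0 := fun h => by simp [h] at hpos
  have hz : riemannZeta s = 0 := by
    rw [riemannXi_eq_riemannZeta hpos h1] at hs
    exact (mul_eq_zero.mp hs).resolve_left (mul_ne_zero (mul_ne_zero h0
      (sub_ne_zero.mpr h1.symm)) (Complex.Gammaℝ_ne_zero_of_re_pos hpos))
  -- The trivial zeros are excluded because Re s > 0.
  refine hRH s hz ?_ h1
  rintro ⟨n, rfl⟩
  have : (-2 * ((n : ℂ) + 1)).re = -2 * ((n : ℝ) + 1) := by simp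
  rw [this] at hpos
  have : (0 : ℝ) ≤ n := by positivity
  linarith

theorem exists_norm_riemannXi_two_add_le :
    ∃ C : ℝ, ∀ w : ℂ, ‖riemannXi (2 + w)‖ ≤ Real.exp (C + (‖w‖ + 6) * Real.log (‖w‖ + 4)) := by
  obtain ⟨C, hC, h⟩ := exists_norm_completedRiemannZeta₀_le
  refine ⟨Real.log (C + 1), fun w => ?_⟩
  set r := ‖w‖ + 4 with hr
  have hr4 : 4 ≤ r := by linarith [norm_nonneg w]
  have hs : ‖2 + w‖ + 2 ≤ r := by
    have := norm_add_le 2 w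
    rw [Complex.norm_ofNat] at this
    linarith
  have hlog : 0 ≤ Real.log r := Real.log_nonneg (by linarith)
  set E := Real.exp (r * Real.log r)
  have hE : 1 ≤ E := Real.one_le_exp (by positivity)
  have h1 : ‖completedRiemannZeta₀ (2 + w)‖ ≤ C * E := by
    refine (h _).trans (mul_le_mul_of_nonneg_left (Real.exp_le_exp.mpr ?_) hC)
    have := Real.log_le_log (by linarith [norm_nonneg (2 + w)]) hs
    have := Real.log_nonneg (by linarith [norm_nonneg (2 + w)] : 1 ≤ ‖2 + w‖ + 2)
    gcongr
  have h2 : ‖1 - (2 + w)‖ ≤ r := by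
    have := norm_sub_le 1 (2 + w)
    rw [norm_one] at this
    linarith
  have h3 : ‖riemannXi (2 + w)‖ ≤ (C + 1) * r ^ 2 * E := by
    calc ‖riemannXi (2 + w)‖ ≤ ‖2 + w‖ * ‖1 - (2 + w)‖ * ‖completedRiemannZeta₀ (2 + w)‖ + 1 := by
          rw [← norm_mul, ← norm_mul, riemannXi]
          exact (norm_sub_le _ _).trans (by rw [norm_one])
      _ ≤ r * r * (C * E) + 1 := by
          gcongr
          linarith
      _ ≤ (C + 1) * r ^ 2 * E := by nlinarith [mul_le_mul hr4 hE zero_le_one (by linarith)]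
  -- The 6 in the exponent is 4 + 2: with r = |w|+4, the quadratic factor r² contributes 2 log r.
  refine h3.trans (le_of_eq ?_)
  have : Real.log (C + 1) + (‖w‖ + 6) * Real.log r =
      Real.log (C + 1) + 2 * Real.log r + r * Real.log r := by
    rw [hr]; ring
  rw [this, Real.exp_add, Real.exp_add, Real.exp_log (by linarith), mul_comm 2,
    ← Real.rpow_def_of_pos (by linarith), Real.rpow_two]

/-! ### Zeros on the critical line, their multiplicities and symmetry -/

theorem criticalPoint_re (t : ℝ) : (criticalPoint t).re = 1 / 2 := by
  norm_num [criticalPoint]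

theorem criticalPoint_im (t : ℝ) : (criticalPoint t).im = t := by
  norm_num [criticalPoint]

theorem criticalPoint_ne_zero (t : ℝ) : criticalPoint t ≠ 0 := fun h => by
  have := criticalPoint_re t
  rw [h] at this
  norm_num at this

theorem criticalPoint_ne_one (t : ℝ) : criticalPoint t ≠ 1 := fun h => by
  have := criticalPoint_re t
  rw [h] at this
  norm_num at this

theorem criticalPoint_neg (t : ℝ) : criticalPoint (-t) = 1 - criticalPoint t := by
  simp only [criticalPoint, Complex.ofReal_neg]
  ring

theorem criticalPoint_injective : Function.Injective criticalPoint := fun a b h => by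
  rw [← criticalPoint_im a, h, criticalPoint_im]

theorem Gammaℝ_criticalPoint_ne_zero (t : ℝ) : Complex.Gammaℝ (criticalPoint t) ≠ 0 :=
  Complex.Gammaℝ_ne_zero_of_re_pos (by rw [criticalPoint_re]; norm_num)

theorem riemannXi_criticalPoint_eq_zero_iff {t : ℝ} :
    riemannXi (criticalPoint t) = 0 ↔ riemannZeta (criticalPoint t) = 0 := by
  rw [riemannXi_eq_riemannZeta (by rw [criticalPoint_re]; norm_num) (criticalPoint_ne_one t)]
  simp [criticalPoint_ne_zero, Gammaℝ_criticalPoint_ne_zero, sub_eq_zero,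
    (criticalPoint_ne_one t).symm]

theorem Complex.differentiableAt_Gammaℝ {s : ℂ} (hs : 0 < s.re) :
    DifferentiableAt ℂ Complex.Gammaℝ s := by
  have h1 : DifferentiableAt ℂ Complex.Gamma (s / 2) :=
    Complex.differentiableAt_Gamma _ fun m h => by
      have := congrArg Complex.re h
      simp at this
      have : (0 : ℝ) ≤ m := by positivity
      linarith
  have h2 : DifferentiableAt ℂ (fun s : ℂ => Complex.Gamma (s / 2)) s :=
    h1.comp s (differentiableAt_id.div_const 2)
  have hd : DifferentiableAt ℂ (fun s : ℂ => -s / 2) s := by fun_prop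
  exact (hd.const_cpow (Or.inl (by exact_mod_cast Real.pi_ne_zero))).mul h2

theorem analyticAt_Gammaℝ {s : ℂ} (hs : 0 < s.re) : AnalyticAt ℂ Complex.Gammaℝ s := by
  refine DifferentiableOn.analyticAt (s := {s : ℂ | 0 < s.re})
    (fun w hw => (Complex.differentiableAt_Gammaℝ hw).differentiableWithinAt)
    ((isOpen_lt continuous_const Complex.continuous_re).mem_nhds hs)

theorem analyticAt_riemannZeta {s : ℂ} (hs : s ≠ 1) : AnalyticAt ℂ riemannZeta s :=
  DifferentiableOn.analyticAt (s := {1}ᶜ)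
    (fun _ hw => (differentiableAt_riemannZeta hw).differentiableWithinAt)
    (isOpen_compl_singleton.mem_nhds hs)

/-- Near the critical line ξ is ζ times an analytic factor without zeros there, so the orders agree.
-/
theorem analyticOrderNatAt_riemannXi_criticalPoint (t : ℝ) :
    analyticOrderNatAt riemannXi (criticalPoint t) = zeroMult t := by
  have hre : 0 < (criticalPoint t).re := by rw [criticalPoint_re]; norm_num
  have h1 := criticalPoint_ne_one t
  set g : ℂ → ℂ := fun s => s * (1 - s) * Complex.Gammaℝ s with hg
  have hga : AnalyticAt ℂ g (criticalPoint t) := by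
    have := analyticAt_Gammaℝ hre
    fun_prop
  have hg0 : g (criticalPoint t) ≠ 0 := mul_ne_zero (mul_ne_zero (criticalPoint_ne_zero t)
    (sub_ne_zero.mpr h1.symm)) (Gammaℝ_criticalPoint_ne_zero t)
  have heq : riemannXi =ᶠ[𝓝 (criticalPoint t)] g * riemannZeta := by
    filter_upwards [(isOpen_lt continuous_const Complex.continuous_re).mem_nhds hre,
      isOpen_compl_singleton.mem_nhds h1] with s hs hs1
    exact riemannXi_eq_riemannZeta hs hs1
  rw [zeroMult, analyticOrderNatAt, analyticOrderNatAt, analyticOrderAt_congr heq,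
    analyticOrderAt_mul hga (analyticAt_riemannZeta h1),
    analyticOrderAt_eq_zero.mpr (Or.inr hg0), zero_add]

theorem zeroMult_neg (t : ℝ) : zeroMult (-t) = zeroMult t := by
  rw [← analyticOrderNatAt_riemannXi_criticalPoint, ← analyticOrderNatAt_riemannXi_criticalPoint,
    criticalPoint_neg]
  have hcomp : riemannXi ∘ (fun s => 1 - s) = riemannXi := funext riemannXi_one_sub
  have hd : deriv (fun s : ℂ => 1 - s) (criticalPoint t) ≠ 0 := by
    rw [deriv_const_sub, deriv_id'']
    norm_num
  have := analyticOrderAt_comp_of_deriv_ne_zero (f := riemannXi) (g := fun s : ℂ => 1 - s)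
    (z₀ := criticalPoint t) (by fun_prop) hd
  rw [hcomp] at this
  rw [analyticOrderNatAt, analyticOrderNatAt, this]

theorem riemannZeta_criticalPoint_neg_eq_zero_iff {t : ℝ} :
    riemannZeta (criticalPoint (-t)) = 0 ↔ riemannZeta (criticalPoint t) = 0 := by
  rw [← riemannXi_criticalPoint_eq_zero_iff, criticalPoint_neg, riemannXi_one_sub,
    riemannXi_criticalPoint_eq_zero_iff]

/-- The symmetry `γ ↦ -γ` of the zero ordinates. -/
def negZeroOrdinate : ZeroOrdinate ≃ ZeroOrdinate where
  toFun γ := ⟨-γ.1, riemannZeta_criticalPoint_neg_eq_zero_iff.mpr γ.2⟩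
  invFun γ := ⟨-γ.1, riemannZeta_criticalPoint_neg_eq_zero_iff.mpr γ.2⟩
  left_inv γ := by simp
  right_inv γ := by simp

theorem finite_zeroOrdinate_norm_le (c : ℂ) (R : ℝ) :
    {γ : ZeroOrdinate | ‖criticalPoint γ.1 - c‖ ≤ R}.Finite := by
  have h := (isCompact_closedBall c R).inter_riemannZetaZeros_finite
  refine (h.preimage (f := fun γ : ZeroOrdinate => criticalPoint γ.1)
    (fun a _ b _ hab => Subtype.ext (criticalPoint_injective hab))).subset fun γ hγ => ?_
  exact ⟨mem_closedBall_iff_norm.mpr hγ, γ.2⟩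

theorem finite_zeroOrdinate_abs_le (R : ℝ) : {γ : ZeroOrdinate | |γ.1| ≤ R}.Finite := by
  refine (finite_zeroOrdinate_norm_le (1 / 2) R).subset fun γ hγ => ?_
  simpa [criticalPoint] using hγ

noncomputable section

/-- The zero ordinates for which the zero lies within distance `n` of the point `2`. -/
def zerosNearTwo (n : ℕ) : Finset ZeroOrdinate := (finite_zeroOrdinate_norm_le 2 n).toFinset

end

theorem mem_zerosNearTwo {n : ℕ} {γ : ZeroOrdinate} :
    γ ∈ zerosNearTwo n ↔ ‖criticalPoint γ.1 - 2‖ ≤ n := by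
  simp [zerosNearTwo]

theorem tendsto_zerosNearTwo : Tendsto zerosNearTwo atTop atTop := by
  refine tendsto_atTop_finset_of_monotone (fun m n hmn γ hγ => ?_) fun γ => ?_
  · rw [mem_zerosNearTwo] at hγ ⊢
    exact hγ.trans (by exact_mod_cast hmn)
  · obtain ⟨n, hn⟩ := exists_nat_ge ‖criticalPoint γ.1 - 2‖
    exact ⟨n, mem_zerosNearTwo.mpr hn⟩

theorem exists_criticalPoint_eq_of_riemannXi_eq_zero (hRH : RiemannHypothesis) {s : ℂ}
    (hs : riemannXi s = 0) : ∃ γ : ZeroOrdinate, criticalPoint γ.1 = s := by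
  have h : criticalPoint s.im = s := by
    apply Complex.ext
    · rw [criticalPoint_re, re_eq_half_of_riemannXi_eq_zero hRH hs]
    · exact criticalPoint_im _
  exact ⟨⟨s.im, riemannXi_criticalPoint_eq_zero_iff.mp (by rw [h]; exact hs)⟩, h⟩

/-! ### Hadamard's expansion for ξ -/

theorem tendsto_growth_div_sq (C : ℝ) :
    Tendsto (fun r : ℝ => (C + (r + 6) * Real.log (r + 4)) / r ^ 2) atTop (𝓝 0) := by
  have hlog : Tendsto (fun r : ℝ => Real.log (r + 4) / (r + 4)) atTop (𝓝 0) :=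
    (Real.isLittleO_log_id_atTop.tendsto_div_nhds_zero).comp
      (tendsto_atTop_add_const_right _ _ tendsto_id)
  have hinv : Tendsto (fun r : ℝ => r⁻¹) atTop (𝓝 0) := tendsto_inv_atTop_zero
  have h := ((hinv.pow 2).const_mul C).add
    (((hinv.const_mul 6).const_add 1).mul (((hinv.const_mul 4).const_add 1).mul hlog))
  norm_num at h
  refine h.congr' ?_
  filter_upwards [eventually_gt_atTop 0] with r hr
  field_simp

theorem logDeriv_riemannXi_one_sub (s : ℂ) :
    logDeriv riemannXi (1 - s) = -logDeriv riemannXi s := by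
  have h : deriv riemannXi s = -deriv riemannXi (1 - s) := by
    conv_lhs => rw [← funext riemannXi_one_sub]
    exact deriv_comp_const_sub riemannXi 1 s
  rw [logDeriv_apply, logDeriv_apply, riemannXi_one_sub, h]
  ring

/-- The general expansion needs a nonzero value at the origin, so ξ is recentered at 2. Under the
Riemann hypothesis the zeros of ξ are exactly the points `criticalPoint γ`. -/
theorem tendsto_sum_zerosNearTwo (hRH : RiemannHypothesis) {s : ℂ} (hs : riemannXi s ≠ 0) :
    Tendsto (fun n => ∑ γ ∈ zerosNearTwo n, (zeroMult γ.1 : ℂ) *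
      (1 / (s - criticalPoint γ.1) + 1 / (criticalPoint γ.1 - 2))) atTop
      (𝓝 (logDeriv riemannXi s - logDeriv riemannXi 2)) := by
  obtain ⟨C, hC⟩ := exists_norm_riemannXi_two_add_le
  set F : ℂ → ℂ := fun w => riemannXi (2 + w) with hF
  have hFd : Differentiable ℂ F := differentiable_riemannXi.comp (by fun_prop)
  have hlogF : ∀ w, logDeriv F w = logDeriv riemannXi (2 + w) := fun w => by
    rw [logDeriv_apply, logDeriv_apply, hF, deriv_comp_const_add]
  have hmul : ∀ γ : ZeroOrdinate,
      analyticOrderNatAt F (criticalPoint γ.1 - 2) = zeroMult γ.1 := fun γ => by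
    have hd : deriv (fun w : ℂ => 2 + w) (criticalPoint γ.1 - 2) ≠ 0 := by
      rw [deriv_const_add, deriv_id'']
      exact one_ne_zero
    have := analyticOrderAt_comp_of_deriv_ne_zero (f := riemannXi) (g := fun w : ℂ => 2 + w)
      (z₀ := criticalPoint γ.1 - 2) (by fun_prop) hd
    rw [← analyticOrderNatAt_riemannXi_criticalPoint, analyticOrderNatAt, analyticOrderNatAt,
      show F = riemannXi ∘ fun w => 2 + w from rfl, this, add_sub_cancel]
  have hinj : Function.Injective fun γ : ZeroOrdinate => criticalPoint γ.1 - 2 := fun a b h =>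
    Subtype.ext (criticalPoint_injective (sub_left_injective h))
  set S : ℕ → Finset ℂ := fun n => (zerosNearTwo n).map ⟨_, hinj⟩ with hS
  have hmem : ∀ n z, z ∈ S n ↔ F z = 0 ∧ ‖z‖ ≤ n := by
    intro n z
    simp only [hS, Finset.mem_map, Function.Embedding.coeFn_mk, mem_zerosNearTwo]
    constructor
    · rintro ⟨γ, hγ, rfl⟩
      refine ⟨?_, hγ⟩
      simp only [hF, add_sub_cancel]
      exact riemannXi_criticalPoint_eq_zero_iff.mpr γ.2
    · rintro ⟨hz, hn⟩
      obtain ⟨γ, hγ⟩ := exists_criticalPoint_eq_of_riemannXi_eq_zero hRH hz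
      refine ⟨γ, ?_, ?_⟩ <;> simp [hγ, hn]
  have h0 : F 0 ≠ 0 := by
    simp only [hF, add_zero]
    exact riemannXi_ne_zero_of_one_le_re (by norm_num)
  have hw : F (s - 2) ≠ 0 := by simpa [hF] using hs
  have := Complex.tendsto_sum_logDeriv hFd h0
    (B := fun r => C + (r + 6) * Real.log (r + 4)) (tendsto_growth_div_sq C) hC hmem hw
  rw [hlogF, hlogF, add_sub_cancel, add_zero] at this
  refine this.congr fun n => ?_
  simp only [hS, Finset.sum_map, Function.Embedding.coeFn_mk, hmul]
  refine Finset.sum_congr rfl fun γ _ => ?_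
  rw [sub_sub_sub_cancel_right]

theorem tendsto_sum_zerosNearTwo_sq (hRH : RiemannHypothesis) {z : ℂ}
    (hz : riemannXi (1 / 2 + z * Complex.I) ≠ 0) :
    Tendsto (fun n => ∑ γ ∈ zerosNearTwo n, (zeroMult γ.1 : ℂ) * (z / (z ^ 2 - γ.1 ^ 2))) atTop
      (𝓝 (Complex.I * logDeriv riemannXi (1 / 2 + z * Complex.I))) := by
  set s := 1 / 2 + z * Complex.I with hs
  have hs' : riemannXi (1 - s) ≠ 0 := by rwa [riemannXi_one_sub]
  -- Subtracting the expansion at 1-s cancels the constants attached to the point 2, and since ξ'/ξ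
  -- is odd under s ↦ 1-s the left sides add up.
  have h := ((tendsto_sum_zerosNearTwo hRH hz).sub (tendsto_sum_zerosNearTwo hRH hs')).const_mul
    (Complex.I / 2)
  have hlim : Complex.I / 2 * (logDeriv riemannXi s - logDeriv riemannXi 2 -
      (logDeriv riemannXi (1 - s) - logDeriv riemannXi 2)) =
      Complex.I * logDeriv riemannXi s := by
    rw [logDeriv_riemannXi_one_sub]
    ring
  rw [hlim] at h
  refine h.congr fun n => ?_
  rw [← Finset.sum_sub_distrib, Finset.mul_sum]
  refine Finset.sum_congr rfl fun γ _ => ?_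
  have hγ := riemannXi_criticalPoint_eq_zero_iff.mpr γ.2
  have h1 : s - criticalPoint γ.1 = (z - γ.1) * Complex.I := by
    rw [hs, criticalPoint]; ring
  have h2 : 1 - s - criticalPoint γ.1 = -((z + γ.1) * Complex.I) := by
    rw [hs, criticalPoint]; ring
  have hz1 : z - γ.1 ≠ 0 := fun h0 => by
    rw [h0, zero_mul, sub_eq_zero] at h1
    exact hz (h1 ▸ hγ)
  have hz2 : z + γ.1 ≠ 0 := fun h0 => by
    rw [h0, zero_mul, neg_zero, sub_eq_zero] at h2
    exact hs' (h2 ▸ hγ)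
  have hz3 : z ^ 2 - (γ.1 : ℂ) ^ 2 ≠ 0 := by
    rw [sq_sub_sq]
    exact mul_ne_zero hz2 hz1
  rw [h1, h2]
  field_simp
  ring

/-- Convergence of the sum of `1 / (9 / 4 + γ ^ 2)` over the zeros. -/
theorem zeroSummable_one_div_add_sq (hRH : RiemannHypothesis) :
    ZeroSummable fun γ => 1 / (9 / 4 + γ ^ 2) := by
  -- The choice z = -3i/2 means s = 2. There every term is i times a nonnegative real, so
  -- convergence along disks bounds all finite partial sums.
  have h2 : (1 / 2 : ℂ) + -(3 / 2 * Complex.I) * Complex.I = 2 := by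
    linear_combination (-3 / 2 : ℂ) * Complex.I_sq
  have hz : riemannXi (1 / 2 + -(3 / 2 * Complex.I) * Complex.I) ≠ 0 := by
    rw [h2]
    exact riemannXi_ne_zero_of_one_le_re (by norm_num)
  have h := (Complex.continuous_im.tendsto _).comp (tendsto_sum_zerosNearTwo_sq hRH hz)
  have hterm : ∀ γ : ℝ, -(3 / 2 * Complex.I) / ((-(3 / 2 * Complex.I)) ^ 2 - (γ : ℂ) ^ 2) =
      ((3 / 2 * (1 / (9 / 4 + γ ^ 2)) : ℝ) : ℂ) * Complex.I := fun γ => by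
    have hne : ((9 : ℂ) / 4 + (γ : ℂ) ^ 2) ≠ 0 := by
      have h : ((9 / 4 + γ ^ 2 : ℝ) : ℂ) ≠ 0 := Complex.ofReal_ne_zero.mpr (by positivity)
      push_cast at h
      exact h
    have : (-(3 / 2 * Complex.I)) ^ 2 - (γ : ℂ) ^ 2 = -(9 / 4 + (γ : ℂ) ^ 2) := by
      linear_combination (9 / 4 : ℂ) * Complex.I_sq
    rw [this]
    push_cast
    field_simp
  obtain ⟨K, hK⟩ := h.bddAbove_range
  refine summable_of_sum_le (c := 2 / 3 * K) (fun γ => by positivity) fun u => ?_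
  obtain ⟨n, hn⟩ := (tendsto_zerosNearTwo.eventually_ge_atTop u).exists
  have hKn := hK ⟨n, rfl⟩
  simp only [Function.comp_apply, Complex.im_sum, hterm] at hKn
  have hsum : ∑ γ ∈ zerosNearTwo n, ((zeroMult γ.1 : ℂ) *
      (((3 / 2 * (1 / (9 / 4 + γ.1 ^ 2)) : ℝ) : ℂ) * Complex.I)).im =
      3 / 2 * ∑ γ ∈ zerosNearTwo n, (zeroMult γ.1 : ℝ) * (1 / (9 / 4 + γ.1 ^ 2)) := by
    rw [Finset.mul_sum]
    refine Finset.sum_congr rfl fun γ _ => ?_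
    rw [← Complex.ofReal_natCast, Complex.im_ofReal_mul, Complex.im_ofReal_mul, Complex.I_im]
    ring
  rw [hsum] at hKn
  have := Finset.sum_le_sum_of_subset_of_nonneg (f := fun γ : ZeroOrdinate =>
    (zeroMult γ.1 : ℝ) * (1 / (9 / 4 + γ.1 ^ 2))) hn (fun γ _ _ => by positivity)
  linarith

/-- Only finitely many ordinates satisfy |γ| ≤ R, so decay beyond R suffices. -/
theorem summable_zeroMult_mul (hRH : RiemannHypothesis) {E : Type*} [NormedRing E]
    [NormOneClass E] [CompleteSpace E] {f : ℝ → E} {C R : ℝ}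
    (hf : ∀ γ : ℝ, R < |γ| → ‖f γ‖ ≤ C / (9 / 4 + γ ^ 2)) :
    Summable fun γ : ZeroOrdinate => (zeroMult γ.1 : E) * f γ.1 := by
  refine Summable.of_norm_bounded_eventually ((zeroSummable_one_div_add_sq hRH).mul_left C) ?_
  refine (finite_zeroOrdinate_abs_le R).subset fun γ hγ => ?_
  by_contra h
  refine hγ ?_
  have h1 := hf γ.1 (not_le.mp h)
  calc ‖(zeroMult γ.1 : E) * f γ.1‖ ≤ ‖(zeroMult γ.1 : E)‖ * ‖f γ.1‖ := norm_mul_le _ _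
    _ ≤ (zeroMult γ.1 : ℝ) * (C / (9 / 4 + γ.1 ^ 2)) := by
        refine mul_le_mul ?_ h1 (norm_nonneg _) (by positivity)
        simpa using Nat.norm_cast_le (α := E) (zeroMult γ.1)
    _ = C * ((zeroMult γ.1 : ℝ) * (1 / (9 / 4 + γ.1 ^ 2))) := by ring

/-- Hadamard's partial fraction expansion of the logarithmic derivative of `ξ`. -/
theorem hasSum_logDeriv_riemannXi (hRH : RiemannHypothesis) {z : ℂ}
    (hz : riemannXi (1 / 2 + z * Complex.I) ≠ 0) :
    HasSum (fun γ : ZeroOrdinate => (zeroMult γ.1 : ℂ) * (z / (z ^ 2 - γ.1 ^ 2)))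
      (Complex.I * logDeriv riemannXi (1 / 2 + z * Complex.I)) := by
  have hbound : ∀ γ : ℝ, 2 * ‖z‖ + 2 < |γ| →
      ‖z / (z ^ 2 - (γ : ℂ) ^ 2)‖ ≤ 4 * ‖z‖ / (9 / 4 + γ ^ 2) := fun γ hγ => by
    have hγ2 : 2 * ‖z‖ ^ 2 + 9 / 4 ≤ γ ^ 2 := by
      rw [← sq_abs γ]
      nlinarith [norm_nonneg z]
    have h1 : (9 / 4 + γ ^ 2) / 4 ≤ ‖z ^ 2 - (γ : ℂ) ^ 2‖ := by
      have := norm_sub_norm_le ((γ : ℂ) ^ 2) (z ^ 2)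
      rw [norm_pow, norm_pow, Complex.norm_real, Real.norm_eq_abs, sq_abs, norm_sub_rev] at this
      linarith [sq_nonneg ‖z‖]
    rw [norm_div]
    calc ‖z‖ / ‖z ^ 2 - (γ : ℂ) ^ 2‖ ≤ ‖z‖ / ((9 / 4 + γ ^ 2) / 4) := by gcongr
      _ = 4 * ‖z‖ / (9 / 4 + γ ^ 2) := by field_simp
  have hsum := summable_zeroMult_mul hRH hbound
  -- Absolute convergence identifies the unconditional sum with the limit along disks.
  have := hsum.hasSum.comp tendsto_zerosNearTwo
  rw [tendsto_nhds_unique (tendsto_sum_zerosNearTwo_sq hRH hz) this]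
  exact hsum.hasSum

/-! ### Factors of the logarithmic derivative of ξ -/

theorem logDeriv_Gammaℝ {s : ℂ} (hs : 0 < s.re) :
    logDeriv Complex.Gammaℝ s =
      ((-(Real.log Real.pi / 2) : ℝ) : ℂ) + 1 / 2 * Complex.digamma (s / 2) := by
  have hpi : (Real.pi : ℂ) ≠ 0 := by exact_mod_cast Real.pi_ne_zero
  have hre : 0 < (s / 2).re := by simpa using hs
  have hG := Complex.Gamma_ne_zero_of_re_pos hre
  have hGd : DifferentiableAt ℂ Complex.Gamma (s / 2) :=
    Complex.differentiableAt_Gamma _ fun m h => by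
      have := congrArg Complex.re h
      simp at this
      have : (0 : ℝ) ≤ m := by positivity
      linarith
  have h1 : HasDerivAt (fun s : ℂ => (Real.pi : ℂ) ^ (-s / 2))
      ((Real.pi : ℂ) ^ (-s / 2) * Complex.log Real.pi * (-1 / 2)) s :=
    ((hasDerivAt_id s).neg.div_const 2).const_cpow (Or.inl hpi)
  have h2 : HasDerivAt (fun s : ℂ => Complex.Gamma (s / 2))
      (deriv Complex.Gamma (s / 2) * (1 / 2)) s :=
    hGd.hasDerivAt.comp s ((hasDerivAt_id s).div_const 2)
  have hcp : (Real.pi : ℂ) ^ (-s / 2) ≠ 0 := by simp [Complex.cpow_eq_zero_iff, Real.pi_ne_zero]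
  have h3 : deriv Complex.Gammaℝ s = _ := (h1.mul h2).deriv
  rw [logDeriv_apply, h3, Complex.Gammaℝ_def, Complex.digamma_def, logDeriv_apply,
    ← Complex.ofReal_log Real.pi_pos.le]
  push_cast
  field_simp

theorem logDeriv_riemannXi {s : ℂ} (hs : 0 < s.re) (h1 : s ≠ 1) (hz : riemannZeta s ≠ 0) :
    logDeriv riemannXi s = 1 / s - 1 / (1 - s) + logDeriv Complex.Gammaℝ s +
      logDeriv riemannZeta s := by
  have h0 : s ≠ 0 := fun h => by simp [h] at hs
  have h1' : 1 - s ≠ 0 := sub_ne_zero.mpr h1.symm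
  have hG := Complex.Gammaℝ_ne_zero_of_re_pos hs
  have hGd := Complex.differentiableAt_Gammaℝ hs
  have heq : riemannXi =ᶠ[𝓝 s] fun s => s * (1 - s) * Complex.Gammaℝ s * riemannZeta s := by
    filter_upwards [(isOpen_lt continuous_const Complex.continuous_re).mem_nhds hs,
      isOpen_compl_singleton.mem_nhds h1] with x hx hx1
    exact riemannXi_eq_riemannZeta hx hx1
  have hp : DifferentiableAt ℂ (fun s : ℂ => s * (1 - s)) s := by fun_prop
  rw [(logDeriv_congr_nhds heq).self_of_nhds,
    logDeriv_mul (f := fun s => s * (1 - s) * Complex.Gammaℝ s) s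
      (mul_ne_zero (mul_ne_zero h0 h1') hG) hz (hp.mul hGd) (differentiableAt_riemannZeta h1),
    logDeriv_mul (f := fun s => s * (1 - s)) s (mul_ne_zero h0 h1') hG hp hGd,
    logDeriv_mul (f := fun s => s) s h0 h1' (by fun_prop) (by fun_prop)]
  have e1 : logDeriv (fun s : ℂ => s) s = 1 / s := by rw [logDeriv_apply, deriv_id'']
  have e2 : logDeriv (fun s : ℂ => 1 - s) s = -(1 / (1 - s)) := by
    rw [logDeriv_apply, deriv_const_sub, deriv_id'']
    ring
  rw [e1, e2]
  ring

/-! ### Critical points of Z and the limit π/4 -/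

theorem hasDerivAt_criticalPoint (t : ℝ) : HasDerivAt criticalPoint Complex.I t := by
  have := (((hasDerivAt_id t).ofReal_comp).mul_const Complex.I).const_add (1 / 2 : ℂ)
  simp only [Complex.ofReal_one, one_mul] at this
  exact this

theorem hasDerivAt_riemannZeta_criticalPoint (t : ℝ) :
    HasDerivAt (fun t => riemannZeta (criticalPoint t))
      (deriv riemannZeta (criticalPoint t) * Complex.I) t :=
  (differentiableAt_riemannZeta (criticalPoint_ne_one t)).hasDerivAt.comp t
    (hasDerivAt_criticalPoint t)

theorem differentiableAt_hardyZ (t : ℝ) : DifferentiableAt ℝ hardyZ t := by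
  have hG : DifferentiableAt ℝ (fun t => Complex.Gammaℝ (criticalPoint t)) t :=
    ((Complex.differentiableAt_Gammaℝ (by rw [criticalPoint_re]; norm_num)).hasDerivAt.comp t
      (hasDerivAt_criticalPoint t)).differentiableAt
  have hN : DifferentiableAt ℝ (fun t => ((‖Complex.Gammaℝ (criticalPoint t)‖ : ℝ) : ℂ)) t :=
    (hG.norm ℝ (Gammaℝ_criticalPoint_ne_zero t)).hasDerivAt.ofReal_comp.differentiableAt
  have hN0 : ((‖Complex.Gammaℝ (criticalPoint t)‖ : ℝ) : ℂ) ≠ 0 :=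
    Complex.ofReal_ne_zero.mpr (norm_ne_zero_iff.mpr (Gammaℝ_criticalPoint_ne_zero t))
  exact Complex.reCLM.differentiableAt.comp t
    ((hG.div hN hN0).mul (hasDerivAt_riemannZeta_criticalPoint t).differentiableAt)

theorem hardyZ_sq (t : ℝ) : hardyZ t ^ 2 = ‖riemannZeta (criticalPoint t)‖ ^ 2 := by
  have h1 : ‖thetaPhase t‖ = 1 := by
    rw [thetaPhase, norm_div, Complex.norm_real, norm_norm,
      div_self (norm_ne_zero_iff.mpr (Gammaℝ_criticalPoint_ne_zero t))]
  rw [← one_mul ‖riemannZeta (criticalPoint t)‖, ← h1, ← norm_mul, ← ofReal_hardyZ,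
    Complex.norm_real, Real.norm_eq_abs, sq_abs]

/-- At a critical point of `Z` the logarithmic derivative of `ζ` is real. -/
theorem im_logDeriv_riemannZeta_eq_zero {t : ℝ} (ht : deriv hardyZ t = 0) :
    (logDeriv riemannZeta (criticalPoint t)).im = 0 := by
  have hZ : HasDerivAt hardyZ 0 t := ht ▸ (differentiableAt_hardyZ t).hasDerivAt
  -- Squaring removes the phase: Z² = |ζ|² has derivative 2 Re(conj ζ · iζ'), whose vanishing is
  -- that of Im(ζ'/ζ).
  have h1 := hZ.fun_pow 2
  simp only [hardyZ_sq] at h1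
  have h2 := h1.unique (hasDerivAt_riemannZeta_criticalPoint t).norm_sq
  simp only [mul_zero, Complex.inner] at h2
  set ζ := riemannZeta (criticalPoint t)
  set ζ' := deriv riemannZeta (criticalPoint t)
  have h3 : ζ.re * ζ'.im - ζ.im * ζ'.re = 0 := by
    simp at h2
    linarith
  rw [logDeriv_apply, Complex.div_im, ← sub_div, div_eq_zero_iff]
  exact Or.inl (by linarith)

theorem riemannZeta_ne_zero_of_isCriticalPointOfZ {t : ℝ} (ht : IsCriticalPointOfZ t) :
    riemannZeta (criticalPoint t) ≠ 0 := by
  obtain ⟨⟨a, b, h, hat, htb⟩, _⟩ := ht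
  exact h.2.2.2.2 t hat htb

theorem pos_of_isCriticalPointOfZ {t : ℝ} (ht : IsCriticalPointOfZ t) : 0 < t := by
  obtain ⟨⟨a, b, h, hat, htb⟩, _⟩ := ht
  exact h.1.trans hat

theorem re_hasSum {f : ZeroOrdinate → ℂ} {a : ℂ} (h : HasSum f a) :
    HasSum (fun γ => (f γ).re) a.re :=
  Complex.reCLM.hasSum h

theorem zeroSum_div_sq_sub_sq (hRH : RiemannHypothesis) {t : ℝ}
    (ht : riemannZeta (criticalPoint t) ≠ 0) :
    zeroSum (fun γ => t / (t ^ 2 - γ ^ 2)) = -(logDeriv riemannXi (criticalPoint t)).im := by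
  have h := re_hasSum (hasSum_logDeriv_riemannXi hRH (z := t)
    (mt riemannXi_criticalPoint_eq_zero_iff.mp ht))
  rw [Complex.I_mul_re] at h
  rw [zeroSum]
  refine Eq.trans (tsum_congr fun γ => ?_) h.tsum_eq
  rw [← Complex.ofReal_natCast, Complex.re_ofReal_mul]
  norm_cast

theorem zeroSum_eq_of_isCriticalPointOfZ (hRH : RiemannHypothesis) {t : ℝ}
    (ht : IsCriticalPointOfZ t) :
    zeroSum (fun γ => t / (t ^ 2 - γ ^ 2)) =
      -(1 / criticalPoint t - 1 / (1 - criticalPoint t)).im -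
        1 / 2 * (Complex.digamma ((1 / 4 : ℝ) + (t / 2 : ℝ) * Complex.I)).im := by
  have hz := riemannZeta_ne_zero_of_isCriticalPointOfZ ht
  have hre : 0 < (criticalPoint t).re := by rw [criticalPoint_re]; norm_num
  have h4 : criticalPoint t / 2 = ((1 / 4 : ℝ) : ℂ) + ((t / 2 : ℝ) : ℂ) * Complex.I := by
    rw [criticalPoint]
    push_cast
    ring
  rw [zeroSum_div_sq_sub_sq hRH hz, logDeriv_riemannXi hre (criticalPoint_ne_one t) hz,
    Complex.add_im, im_logDeriv_riemannZeta_eq_zero ht.2, logDeriv_Gammaℝ hre, h4,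
    Complex.add_im, Complex.add_im, Complex.ofReal_im, zero_add, add_zero,
    show (1 / 2 : ℂ) = ((1 / 2 : ℝ) : ℂ) by push_cast; rfl, Complex.im_ofReal_mul]
  ring

theorem norm_one_div_le_of_im {s : ℂ} {t : ℝ} (ht : 0 < t) (hs : t ≤ |s.im|) :
    ‖1 / s‖ ≤ 1 / t := by
  rw [norm_div, norm_one]
  exact one_div_le_one_div_of_le ht (hs.trans (Complex.abs_im_le_norm s))

theorem tendsto_zeroSum_div_sq_sub_sq (hRH : RiemannHypothesis) {t : ℕ → ℝ}
    (ht : ∀ n, IsCriticalPointOfZ (t n)) (ht_lim : Tendsto t atTop atTop) :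
    Tendsto (fun n => zeroSum (fun γ => t n / (t n ^ 2 - γ ^ 2))) atTop (𝓝 (-(Real.pi / 4))) := by
  have h1 : Tendsto (fun n => (Complex.digamma ((1 / 4 : ℝ) + (t n / 2 : ℝ) * Complex.I)).im)
      atTop (𝓝 (Real.pi / 2)) :=
    (Complex.tendsto_im_digamma (by norm_num : (0 : ℝ) < 1 / 4)).comp
      (ht_lim.atTop_div_const two_pos)
  have h2 : Tendsto (fun n => (1 / criticalPoint (t n) - 1 / (1 - criticalPoint (t n))).im)
      atTop (𝓝 0) := by
    have h3 : Tendsto (fun n => 2 * (1 / t n)) atTop (𝓝 0) := by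
      simpa using (ht_lim.inv_tendsto_atTop).const_mul 2
    refine squeeze_zero_norm (fun n => ?_) h3
    have hpos := pos_of_isCriticalPointOfZ (ht n)
    refine (Complex.abs_im_le_norm _).trans ((norm_sub_le _ _).trans ?_)
    have ha := norm_one_div_le_of_im hpos (s := criticalPoint (t n))
      (by rw [criticalPoint_im]; exact le_abs_self _)
    have hb := norm_one_div_le_of_im hpos (s := 1 - criticalPoint (t n))
      (by rw [← criticalPoint_neg, criticalPoint_im, abs_neg]; exact le_abs_self _)
    linarith
  have h := h2.neg.sub (h1.const_mul (1 / 2))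
  have e : -(0 : ℝ) - 1 / 2 * (Real.pi / 2) = -(Real.pi / 4) := by ring
  rw [e] at h
  exact h.congr fun n => (zeroSum_eq_of_isCriticalPointOfZ hRH (ht n)).symm

/-! ### Growth of ξ'/ξ on the line Re s = 2 -/

open ArithmeticFunction in
theorem exists_norm_logDeriv_riemannZeta_le :
    ∃ C, ∀ s : ℂ, s.re = 2 → ‖logDeriv riemannZeta s‖ ≤ C := by
  have hsum := (LSeriesSummable_vonMangoldt (s := 2) (by norm_num)).norm
  refine ⟨∑' n, ‖LSeries.term (fun n => (Λ n : ℂ)) 2 n‖, fun s hs => ?_⟩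
  have h := LSeries_vonMangoldt_eq_deriv_riemannZeta_div (s := s) (by rw [hs]; norm_num)
  rw [logDeriv_apply, ← norm_neg, ← neg_div, ← h]
  refine tsum_of_norm_bounded hsum.hasSum fun n => le_of_eq ?_
  rw [LSeries.norm_term_eq, LSeries.norm_term_eq, hs, Complex.re_ofNat]

theorem tendsto_re_logDeriv_riemannXi :
    Tendsto (fun t : ℝ => (logDeriv riemannXi (2 + t * Complex.I)).re) atTop atTop := by
  obtain ⟨C, hC⟩ := exists_norm_logDeriv_riemannZeta_le
  -- The constants bound the rest from below: -2 for the two rational terms when t ≥ 1, -log π/2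
  -- from the power of π, and -C for ζ'/ζ.
  have h1 : Tendsto (fun t : ℝ => (-2 - Real.log Real.pi / 2 - C) +
      1 / 2 * (Complex.digamma (1 + (t / 2 : ℝ) * Complex.I)).re) atTop atTop :=
    tendsto_atTop_add_const_left _ _ (Tendsto.const_mul_atTop one_half_pos
      (Complex.tendsto_re_digamma_one_add.comp (tendsto_id.atTop_div_const two_pos)))
  refine tendsto_atTop_mono' _ ?_ h1
  filter_upwards [eventually_ge_atTop 1] with t ht
  set s : ℂ := 2 + t * Complex.I with hs
  have hre : s.re = 2 := by simp [hs]
  have him : s.im = t := by simp [hs]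
  have hs1 : s ≠ 1 := fun h => by
    rw [h] at hre
    norm_num at hre
  have h2 : s / 2 = 1 + ((t / 2 : ℝ) : ℂ) * Complex.I := by
    rw [hs]
    push_cast
    ring
  rw [logDeriv_riemannXi (by rw [hre]; norm_num) hs1
    (riemannZeta_ne_zero_of_one_le_re (by rw [hre]; norm_num)),
    logDeriv_Gammaℝ (by rw [hre]; norm_num), h2, Complex.add_re, Complex.add_re, Complex.add_re,
    Complex.ofReal_re, Complex.sub_re,
    show (1 / 2 : ℂ) = ((1 / 2 : ℝ) : ℂ) by push_cast; rfl, Complex.re_ofReal_mul]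
  have ha := (Complex.abs_re_le_norm _).trans (norm_one_div_le_of_im one_pos (s := s)
    (by rw [him]; exact ht.trans (le_abs_self t)))
  have hb := (Complex.abs_re_le_norm _).trans (norm_one_div_le_of_im one_pos (s := 1 - s)
    (by rw [Complex.sub_im, him, Complex.one_im, zero_sub, abs_neg]; exact ht.trans (le_abs_self t)))
  have hc := (Complex.abs_re_le_norm _).trans (hC s hre)
  rw [abs_le] at ha hb hc
  linarith [ha.1, hb.2, hc.1]

/-! ### Convergence of the series and identities between them -/

section sums

variable {t : ℝ}

theorem sub_ne_zero_of_zeroOrdinate (ht : riemannZeta (criticalPoint t) ≠ 0) (γ : ZeroOrdinate) :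
    t - γ.1 ≠ 0 := fun h => ht (sub_eq_zero.mp h ▸ γ.2)

theorem add_ne_zero_of_zeroOrdinate (ht : riemannZeta (criticalPoint t) ≠ 0) (γ : ZeroOrdinate) :
    t + γ.1 ≠ 0 := by
  rw [← sub_neg_eq_add]
  exact sub_ne_zero_of_zeroOrdinate ht (negZeroOrdinate γ)

theorem zeroSummable_of_abs_le (hRH : RiemannHypothesis) {f : ℝ → ℝ} {C R : ℝ}
    (hf : ∀ γ : ℝ, R < |γ| → |f γ| ≤ C / (9 / 4 + γ ^ 2)) : ZeroSummable f :=
  summable_zeroMult_mul hRH hf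

theorem quarter_le_sq_sub_sq {γ : ℝ} (h : 2 * |t| + 2 < |γ|) :
    (9 / 4 + γ ^ 2) / 4 ≤ γ ^ 2 - t ^ 2 := by
  rw [← sq_abs γ, ← sq_abs t]
  nlinarith [abs_nonneg t]

/-- Any real t is allowed: a vanishing denominator yields the term 0, and only large |γ| matters. -/
theorem zeroSummable_one_div_sq_sub_sq (hRH : RiemannHypothesis) (t : ℝ) :
    ZeroSummable fun γ => 1 / (γ ^ 2 - t ^ 2) := by
  refine zeroSummable_of_abs_le hRH (C := 4) (R := 2 * |t| + 2) fun γ hγ => ?_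
  have h := quarter_le_sq_sub_sq hγ
  have h0 : 0 < (9 / 4 + γ ^ 2) / 4 := by positivity
  rw [abs_of_pos (by positivity [h0.trans_le h])]
  calc 1 / (γ ^ 2 - t ^ 2) ≤ 1 / ((9 / 4 + γ ^ 2) / 4) := one_div_le_one_div_of_le h0 h
    _ = 4 / (9 / 4 + γ ^ 2) := by field_simp

theorem zeroSummable_sq_div (hRH : RiemannHypothesis) (t : ℝ) :
    ZeroSummable fun γ => γ ^ 2 / (t ^ 2 - γ ^ 2) ^ 2 := by
  refine zeroSummable_of_abs_le hRH (C := 16) (R := 2 * |t| + 2) fun γ hγ => ?_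
  have h := quarter_le_sq_sub_sq hγ
  have h0 : 0 < (9 / 4 + γ ^ 2) / 4 := by positivity
  rw [abs_of_nonneg (by positivity)]
  calc γ ^ 2 / (t ^ 2 - γ ^ 2) ^ 2 = γ ^ 2 / (γ ^ 2 - t ^ 2) ^ 2 := by ring
    _ ≤ (9 / 4 + γ ^ 2) / ((9 / 4 + γ ^ 2) / 4) ^ 2 := by
        gcongr
        linarith
    _ = 16 / (9 / 4 + γ ^ 2) := by
        field_simp
        norm_num

theorem zeroSummable_const_sq_div (hRH : RiemannHypothesis)
    (ht : riemannZeta (criticalPoint t) ≠ 0) :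
    ZeroSummable fun γ => t ^ 2 / (t ^ 2 - γ ^ 2) ^ 2 := by
  -- Termwise, t²/(t²-γ²)² = γ²/(t²-γ²)² - 1/(γ²-t²).
  refine ((zeroSummable_sq_div hRH t).sub (zeroSummable_one_div_sq_sub_sq hRH t)).congr
    fun γ => ?_
  have h1 := sub_ne_zero_of_zeroOrdinate ht γ
  have h2 := add_ne_zero_of_zeroOrdinate ht γ
  have h3 : t ^ 2 - γ.1 ^ 2 ≠ 0 := by
    rw [sq_sub_sq]
    exact mul_ne_zero h2 h1
  have h4 : γ.1 ^ 2 - t ^ 2 = -(t ^ 2 - γ.1 ^ 2) := by ring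
  simp only [h4]
  field_simp
  ring

theorem zeroSummable_one_div_sub_sq (hRH : RiemannHypothesis) (t : ℝ) :
    ZeroSummable fun γ => 1 / (t - γ) ^ 2 := by
  refine zeroSummable_of_abs_le hRH (C := 16) (R := 2 * |t| + 2) fun γ hγ => ?_
  have h0 : 0 < 9 / 4 + γ ^ 2 := by positivity
  have h : (9 / 4 + γ ^ 2) / 16 ≤ (t - γ) ^ 2 := by
    have h1 : |γ| - |t| ≤ |t - γ| := by
      rw [abs_sub_comm]
      exact abs_sub_abs_le_abs_sub γ t
    rw [← sq_abs γ, ← sq_abs (t - γ)]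
    have h2 : |γ| / 2 + 1 ≤ |t - γ| := by linarith
    nlinarith [abs_nonneg γ]
  rw [abs_of_nonneg (by positivity)]
  calc 1 / (t - γ) ^ 2 ≤ 1 / ((9 / 4 + γ ^ 2) / 16) := one_div_le_one_div_of_le (by positivity) h
    _ = 16 / (9 / 4 + γ ^ 2) := by field_simp

theorem zeroSum_const_sq_div_sub (hRH : RiemannHypothesis)
    (ht : riemannZeta (criticalPoint t) ≠ 0) :
    zeroSum (fun γ => t ^ 2 / (t ^ 2 - γ ^ 2) ^ 2) - zeroSum (fun γ => γ ^ 2 / (t ^ 2 - γ ^ 2) ^ 2) =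
      -zeroSum (fun γ => 1 / (γ ^ 2 - t ^ 2)) := by
  unfold zeroSum
  rw [← (zeroSummable_const_sq_div hRH ht).tsum_sub (zeroSummable_sq_div hRH t), ← tsum_neg]
  refine tsum_congr fun γ => ?_
  have h3 : t ^ 2 - γ.1 ^ 2 ≠ 0 := by
    rw [sq_sub_sq]
    exact mul_ne_zero (add_ne_zero_of_zeroOrdinate ht γ) (sub_ne_zero_of_zeroOrdinate ht γ)
  have h4 : γ.1 ^ 2 - t ^ 2 = -(t ^ 2 - γ.1 ^ 2) := by ring
  simp only [h4]
  field_simp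

/-- Averaging over γ ↦ -γ replaces 1/(t-γ)² by half of 1/(t-γ)² + 1/(t+γ)², which is
(t²+γ²)/(t²-γ²)². -/
theorem zeroSum_one_div_sub_sq (hRH : RiemannHypothesis)
    (ht : riemannZeta (criticalPoint t) ≠ 0) :
    zeroSum (fun γ => 1 / (t - γ) ^ 2) =
      zeroSum (fun γ => t ^ 2 / (t ^ 2 - γ ^ 2) ^ 2) +
        zeroSum (fun γ => γ ^ 2 / (t ^ 2 - γ ^ 2) ^ 2) := by
  have hs := zeroSummable_one_div_sub_sq hRH t
  have hneg : zeroSum (fun γ => 1 / (t - γ) ^ 2) = zeroSum (fun γ => 1 / (t + γ) ^ 2) := by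
    unfold zeroSum
    rw [← negZeroOrdinate.tsum_eq]
    refine tsum_congr fun γ => ?_
    simp only [negZeroOrdinate, Equiv.coe_fn_mk, zeroMult_neg, sub_neg_eq_add]
  have hs' : ZeroSummable fun γ => 1 / (t + γ) ^ 2 := by
    refine (negZeroOrdinate.summable_iff.mpr hs).congr fun γ => ?_
    simp only [Function.comp_apply, negZeroOrdinate, Equiv.coe_fn_mk, zeroMult_neg, sub_neg_eq_add]
  have htwo : zeroSum (fun γ => 1 / (t - γ) ^ 2) =
      1 / 2 * (zeroSum (fun γ => 1 / (t - γ) ^ 2) + zeroSum (fun γ => 1 / (t + γ) ^ 2)) := by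
    rw [← hneg]
    ring
  rw [htwo]
  unfold zeroSum
  rw [← Summable.tsum_add hs hs', ← tsum_mul_left,
    ← Summable.tsum_add (zeroSummable_const_sq_div hRH ht) (zeroSummable_sq_div hRH t)]
  refine tsum_congr fun γ => ?_
  have h1 := sub_ne_zero_of_zeroOrdinate ht γ
  have h2 := add_ne_zero_of_zeroOrdinate ht γ
  simp only [show t ^ 2 - γ.1 ^ 2 = (t + γ.1) * (t - γ.1) by ring]
  field_simp
  ring

/-- At z = t - 3i/2 the real part of ξ'/ξ is a sum of Poisson kernels (3/2)/((t∓γ)²+9/4), averaged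
over both signs. Dropping 9/4 from the denominators gives the bound that forces ∑ 1/(t-γ)² to
infinity. -/
theorem re_logDeriv_riemannXi_le (hRH : RiemannHypothesis)
    (ht : riemannZeta (criticalPoint t) ≠ 0) :
    (logDeriv riemannXi (2 + t * Complex.I)).re ≤ 3 / 2 * zeroSum (fun γ => 1 / (t - γ) ^ 2) := by
  set z : ℂ := t - 3 / 2 * Complex.I with hz
  have hs : 1 / 2 + z * Complex.I = 2 + t * Complex.I := by
    rw [hz]
    linear_combination (-3 / 2 : ℂ) * Complex.I_sq
  have h := hasSum_logDeriv_riemannXi hRH (z := z) (by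
    rw [hs]
    exact riemannXi_ne_zero_of_one_le_re (by simp))
  rw [hs] at h
  have h' := Complex.imCLM.hasSum h
  simp only [Complex.imCLM_apply, Complex.I_mul_im] at h'
  have hsum := ((zeroSummable_const_sq_div hRH ht).add (zeroSummable_sq_div hRH t)).mul_left (3 / 2)
  rw [zeroSum_one_div_sub_sq hRH ht]
  unfold zeroSum
  rw [← Summable.tsum_add (zeroSummable_const_sq_div hRH ht) (zeroSummable_sq_div hRH t),
    ← tsum_mul_left]
  refine hasSum_le (fun γ => ?_) h' hsum.hasSum
  have h1 := sub_ne_zero_of_zeroOrdinate ht γ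
  have h2 := add_ne_zero_of_zeroOrdinate ht γ
  have him : ∀ x : ℝ, (1 / ((x : ℂ) - 3 / 2 * Complex.I)).im = 3 / 2 / (x ^ 2 + 9 / 4) := fun x => by
    rw [one_div, Complex.inv_im]
    simp [Complex.normSq_apply]
    ring
  have hne : ∀ x : ℝ, (x : ℂ) - 3 / 2 * Complex.I ≠ 0 := fun x hx => by
    have := congrArg Complex.im hx
    norm_num at this
  have hz1 : z - γ.1 = ((t - γ.1 : ℝ) : ℂ) - 3 / 2 * Complex.I := by
    rw [hz]; push_cast; ring
  have hz2 : z + γ.1 = ((t + γ.1 : ℝ) : ℂ) - 3 / 2 * Complex.I := by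
    rw [hz]; push_cast; ring
  have hdecomp : z / (z ^ 2 - (γ.1 : ℂ) ^ 2) = ((1 / 2 : ℝ) : ℂ) *
      (1 / (((t - γ.1 : ℝ) : ℂ) - 3 / 2 * Complex.I) +
        1 / (((t + γ.1 : ℝ) : ℂ) - 3 / 2 * Complex.I)) := by
    have ha := hne (t - γ.1)
    have hb := hne (t + γ.1)
    rw [← hz1] at ha ⊢
    rw [← hz2] at hb ⊢
    rw [sq_sub_sq]
    push_cast
    field_simp
    ring
  rw [hdecomp, ← Complex.ofReal_natCast, Complex.im_ofReal_mul, Complex.im_ofReal_mul,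
    Complex.add_im, him, him]
  have hle : ∀ x : ℝ, x ≠ 0 → 3 / 2 / (x ^ 2 + 9 / 4) ≤ 3 / 2 * (1 / x ^ 2) := fun x hx => by
    rw [mul_one_div]
    exact div_le_div_of_nonneg_left (by norm_num) (by positivity) (by linarith)
  have hfin : 3 / 2 * (t ^ 2 / (t ^ 2 - γ.1 ^ 2) ^ 2 + γ.1 ^ 2 / (t ^ 2 - γ.1 ^ 2) ^ 2) =
      1 / 2 * (3 / 2 * (1 / (t - γ.1) ^ 2) + 3 / 2 * (1 / (t + γ.1) ^ 2)) := by
    rw [show t ^ 2 - γ.1 ^ 2 = (t + γ.1) * (t - γ.1) by ring]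
    field_simp
    ring
  have hkey : 1 / 2 * (3 / 2 / ((t - γ.1) ^ 2 + 9 / 4) + 3 / 2 / ((t + γ.1) ^ 2 + 9 / 4)) ≤
      3 / 2 * (t ^ 2 / (t ^ 2 - γ.1 ^ 2) ^ 2 + γ.1 ^ 2 / (t ^ 2 - γ.1 ^ 2) ^ 2) := by
    rw [hfin]
    linarith [hle _ h1, hle _ h2]
  refine (mul_le_mul_of_nonneg_left hkey (Nat.cast_nonneg (α := ℝ) (zeroMult γ.1))).trans
    (le_of_eq ?_)
  ring

end sums

/-! ### Assembly of the asymptotic formulae -/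

theorem isEquivalent_of_tendsto_sub {u v : ℕ → ℝ} (hv : Tendsto v atTop atTop)
    (huv : Tendsto (fun n => u n - v n) atTop (𝓝 0)) : u ~[atTop] v :=
  (huv.isBigO_one ℝ).trans_isLittleO
    (isLittleO_const_left.mpr (Or.inr (tendsto_norm_atTop_atTop.comp hv)))

theorem mainTheorem7 (hRH : RiemannHypothesis) (t : ℕ → ℝ)
    (ht : ∀ n, IsCriticalPointOfZ (t n)) (ht_lim : Tendsto t atTop atTop) :
    -- all the series converge absolutely
    (∀ n, ZeroSummable (fun γ => 1 / (t n - γ) ^ 2) ∧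
      ZeroSummable (fun γ => 1 / (γ ^ 2 - t n ^ 2)) ∧
      ZeroSummable (fun γ => t n ^ 2 / (t n ^ 2 - γ ^ 2) ^ 2) ∧
      ZeroSummable (fun γ => γ ^ 2 / (t n ^ 2 - γ ^ 2) ^ 2)) ∧
    -- the limit relation and its reformulation
    Tendsto (fun n => zeroSum (fun γ => t n / (γ ^ 2 - t n ^ 2))) atTop (𝓝 (Real.pi / 4)) ∧
    (fun n => zeroSum (fun γ => 1 / (γ ^ 2 - t n ^ 2))) ~[atTop]
      (fun n => Real.pi / (4 * t n)) ∧
    -- formula (A), as an equivalence of the two sides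
    (fun n => zeroSum (fun γ => 1 / (t n - γ) ^ 2)) ~[atTop]
      (fun n => 2 * zeroSum (fun γ => t n ^ 2 / (t n ^ 2 - γ ^ 2) ^ 2) - Real.pi / (4 * t n)) ∧
    -- formula (A), at the precision of the term `π / (4 t)`
    (fun n => zeroSum (fun γ => 1 / (t n - γ) ^ 2) -
        2 * zeroSum (fun γ => γ ^ 2 / (t n ^ 2 - γ ^ 2) ^ 2)) ~[atTop]
      (fun n => -(Real.pi / (4 * t n))) ∧
    -- formula (B), as an equivalence of the two sides
    (fun n => zeroSum (fun γ => t n ^ 2 / (t n ^ 2 - γ ^ 2) ^ 2)) ~[atTop]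
      (fun n => zeroSum (fun γ => γ ^ 2 / (t n ^ 2 - γ ^ 2) ^ 2) - Real.pi / (4 * t n)) ∧
    -- formula (B), at the precision of the term `π / (4 t)`
    (fun n => zeroSum (fun γ => t n ^ 2 / (t n ^ 2 - γ ^ 2) ^ 2) -
        zeroSum (fun γ => γ ^ 2 / (t n ^ 2 - γ ^ 2) ^ 2)) ~[atTop]
      (fun n => -(Real.pi / (4 * t n))) := by
  have hz : ∀ n, riemannZeta (criticalPoint (t n)) ≠ 0 := fun n =>
    riemannZeta_ne_zero_of_isCriticalPointOfZ (ht n)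
  have hpos : ∀ n, t n ≠ 0 := fun n => (pos_of_isCriticalPointOfZ (ht n)).ne'
  set U : ℕ → ℝ := fun n => zeroSum (fun γ => 1 / (t n - γ) ^ 2) with hU
  set A : ℕ → ℝ := fun n => zeroSum (fun γ => t n ^ 2 / (t n ^ 2 - γ ^ 2) ^ 2) with hA
  set B : ℕ → ℝ := fun n => zeroSum (fun γ => γ ^ 2 / (t n ^ 2 - γ ^ 2) ^ 2) with hB
  set V : ℕ → ℝ := fun n => zeroSum (fun γ => 1 / (γ ^ 2 - t n ^ 2)) with hV
  have hAB : ∀ n, A n - B n = -V n := fun n => zeroSum_const_sq_div_sub hRH (hz n)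
  have hUAB : ∀ n, U n = A n + B n := fun n => zeroSum_one_div_sub_sq hRH (hz n)
  have hS : Tendsto (fun n => zeroSum (fun γ => t n / (γ ^ 2 - t n ^ 2))) atTop
      (𝓝 (Real.pi / 4)) := by
    have h := (tendsto_zeroSum_div_sq_sub_sq hRH ht ht_lim).neg
    rw [neg_neg] at h
    refine h.congr fun n => ?_
    unfold zeroSum
    rw [← tsum_neg]
    refine tsum_congr fun γ => ?_
    simp only [← neg_sub (γ.1 ^ 2) (t n ^ 2), div_neg, mul_neg, neg_neg]
  have hSV : ∀ n, zeroSum (fun γ => t n / (γ ^ 2 - t n ^ 2)) / t n = V n := fun n => by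
    simp only [hV, zeroSum]
    rw [← tsum_div_const]
    refine tsum_congr fun γ => ?_
    rw [mul_div_assoc, div_div, mul_comm (_ - _), ← div_div, div_self (hpos n)]
  have hinv : Tendsto (fun n => Real.pi / (4 * t n)) atTop (𝓝 0) :=
    tendsto_const_nhds.div_atTop (ht_lim.const_mul_atTop (by norm_num))
  have hV0 : Tendsto V atTop (𝓝 0) := (hS.div_atTop ht_lim).congr hSV
  have hVequiv : V ~[atTop] fun n => Real.pi / (4 * t n) := by
    have h1 := ((isEquivalent_const_iff_tendsto (by positivity)).mpr hS).div
      (IsEquivalent.refl (u := t))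
    refine (h1.congr_left (Eventually.of_forall hSV)).congr_right (Eventually.of_forall fun n => ?_)
    simp only [Pi.div_apply, Function.const_apply]
    rw [div_div]
  have hUtop : Tendsto U atTop atTop := by
    have h1 := (tendsto_re_logDeriv_riemannXi.comp ht_lim).const_mul_atTop
      (by norm_num : (0 : ℝ) < 2 / 3)
    refine tendsto_atTop_mono (fun n => ?_) h1
    have := re_logDeriv_riemannXi_le hRH (hz n)
    simp only [Function.comp_apply]
    linarith
  refine ⟨fun n => ⟨zeroSummable_one_div_sub_sq hRH _, zeroSummable_one_div_sq_sub_sq hRH _,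
    zeroSummable_const_sq_div hRH (hz n), zeroSummable_sq_div hRH _⟩, hS, hVequiv, ?_, ?_, ?_, ?_⟩
  -- Here 2A = U - V, so the right side is U - (V + π/(4t)) → ∞, and the two sides differ by V +
  -- π/(4t) → 0.
  · refine isEquivalent_of_tendsto_sub ?_ ?_
    · refine (hUtop.atTop_add (hV0.add hinv).neg).congr fun n => ?_
      linarith [hAB n, hUAB n]
    · refine (by simpa using hV0.add hinv : Tendsto (fun n => V n + Real.pi / (4 * t n)) atTop
        (𝓝 0)).congr fun n => ?_
      linarith [hAB n, hUAB n]
  · refine hVequiv.neg.congr_left (Eventually.of_forall fun n => ?_)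
    change -V n = U n - 2 * B n
    linarith [hAB n, hUAB n]
  -- Here B = (U + V)/2, so the right side again tends to infinity, and the difference is π/(4t) - V
  -- → 0.
  · refine isEquivalent_of_tendsto_sub ?_ ?_
    · refine ((hUtop.const_mul_atTop (one_half_pos (α := ℝ))).atTop_add
        ((hV0.const_mul (1 / 2)).sub hinv)).congr fun n => ?_
      linarith [hAB n, hUAB n]
    · refine (by simpa using hinv.sub hV0 : Tendsto (fun n => Real.pi / (4 * t n) - V n) atTop
        (𝓝 0)).congr fun n => ?_
      linarith [hAB n, hUAB n]
  · refine hVequiv.neg.congr_left (Eventually.of_forall fun n => ?_)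
    exact (hAB n).symm
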